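/- There are absolute constants $C>0$ and $k\in\mathbb N$ such that the following holds. Let $H\ge 1$, $N\ge 1$, let $\mathcal S$ be a state space with $|\mathcal S|=3$ and $\mathcal A$ a finite non-empty action set, and let an episodic MDP of horizon $H$ be given by an initial distribution $\rho$ on $\mathcal S$ and time-dependent transition kernels $P_t(\cdot\mid s,a)$, $1\le t<H$. For a (randomized, time-dependent) policy $\pi$ write $\Pr_\pi$ for the law of the trajectory $(s_1,a_1,\dots,s_H,a_H)$ and $J_{\mathbf r}(\pi)=\mathbb E_\pi\big[\sum_{t=1}^H \mathbf r_t(s_t,a_t)\big]$. Then there is a learner, depending on $\rho,(P_t),N$ but neither on the expert nor on a reward function, which maps every dataset $D$ of $N$ trajectories to a policy $\widehat\pi=\widehat\pi(D)$, such that for every deterministic time-dependent expert policy $\pi^*$: 1. (Sample splitting.) If all actions recorded in $D$ are those of $\pi^*$, then at each time $t$ and each state $s$ that is visited at time $t$ in one of the first $\lfloor N/2\rfloor$ trajectories of $D$, $\widehat\pi$ plays the action $\pi^*_t(s)$ with probability one. 2. (Bias at the final step.) If $D$ consists of $N$ independent trajectories drawn from $\Pr_{\pi^*}$, then $$\frac12\sum_{s\in\mathcal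 S}\sum_{a\in\mathcal A}\Big|\mathbb E_D\big[\Pr_{\widehat\pi(D)}(s_H=s,a_H=a)\big]-\Pr_{\pi^*}(s_H=s,a_H=a)\Big|\le \frac{C\,(1+\log(NH))^k}{N}.$$ 3. (Suboptimality at the final step.) For every reward function $\mathbf r$ with values in $[0,1]$ and $\mathbf r_t=0$ for all $t<H$, $$\big|J_{\mathbf r}(\pi^*)-\mathbb E_D[J_{\mathbf r}(\widehat\pi(D))]\big|\le \frac{C\,(1+\log(NH))^k}{N}.$$ That is, with known transitions every 3-state MDP admits a learner whose bias and suboptimality at the final step are $\widetilde O(1/N)$. -/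

import Mathlib

noncomputable section

/-- A tabular episodic MDP (without reward) of horizon `H = T + 1`, with time-dependent
transitions. The decision times are `0, …, T`, and `P t s a` is the law of the state at time
`t + 1` given the state `s` and the action `a` at time `t`. -/
structure EpisodicMDP (S A : Type) [Fintype S] (T : ℕ) where
  ρ : S → ℝ
  P : Fin T → S → A → S → ℝ
  ρ_nonneg : ∀ s, 0 ≤ ρ s
  ρ_sum : ∑ s, ρ s = 1
  P_nonneg : ∀ t s a s', 0 ≤ P t s a s'
  P_sum : ∀ t s a, ∑ s', P t s a s' = 1

/-- A (randomized, time-dependent) policy: `prob t s a = π_t(a | s)`. -/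
structure RandPolicy (S A : Type) [Fintype A] (T : ℕ) where
  prob : Fin (T + 1) → S → A → ℝ
  prob_nonneg : ∀ t s a, 0 ≤ prob t s a
  prob_sum : ∀ t s, ∑ a, prob t s a = 1

/-- A deterministic time-dependent policy. -/
abbrev DetPolicy (S A : Type) (T : ℕ) := Fin (T + 1) → S → A

/-- A trajectory `(s_t, a_t)_{t = 0, …, T}`. -/
abbrev Traj (S A : Type) (T : ℕ) := Fin (T + 1) → S × A

/-- A dataset of `N` trajectories. -/
abbrev Dataset (S A : Type) (T N : ℕ) := Fin N → Traj S A T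

/-- A learner maps datasets to policies. It sees only the dataset; since it may be chosen
after the MDP, it knows the initial law and the transitions. -/
abbrev Learner (S A : Type) [Fintype A] (T N : ℕ) := Dataset S A T N → RandPolicy S A T

variable {S A : Type} [Fintype S] [DecidableEq S] [Fintype A] [DecidableEq A] {T N : ℕ}

/-- A deterministic policy regarded as a randomized one. -/
def DetPolicy.toRand (π : DetPolicy S A T) : RandPolicy S A T where
  prob t s a := if a = π t s then 1 else 0
  prob_nonneg t s a := by split_ifs <;> norm_num
  prob_sum t s := by simp

namespace EpisodicMDP

/-- The probability of a trajectory when the policy `π` is played. -/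
def trajProb (M : EpisodicMDP S A T) (π : RandPolicy S A T) (τ : Traj S A T) : ℝ :=
  M.ρ (τ 0).1 * (∏ t : Fin T, M.P t (τ t.castSucc).1 (τ t.castSucc).2 (τ t.succ).1) *
    ∏ t : Fin (T + 1), π.prob t (τ t).1 (τ t).2

/-- `Pr_π(s_t = s, a_t = a)`. -/
def occ (M : EpisodicMDP S A T) (π : RandPolicy S A T) (t : Fin (T + 1)) (s : S) (a : A) : ℝ :=
  ∑ τ : Traj S A T, if τ t = (s, a) then M.trajProb π τ else 0

/-- `J_r(π)`, the expected total reward of `π` for the reward function `r`. -/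
def value (M : EpisodicMDP S A T) (r : Fin (T + 1) → S → A → ℝ) (π : RandPolicy S A T) : ℝ :=
  ∑ τ : Traj S A T, M.trajProb π τ * ∑ t : Fin (T + 1), r t (τ t).1 (τ t).2

/-- The expectation of `F D` over a dataset `D` of `N` independent trajectories of `π`. -/
def dataExp (M : EpisodicMDP S A T) (π : RandPolicy S A T) (F : Dataset S A T N → ℝ) : ℝ :=
  ∑ D : Dataset S A T N, (∏ i, M.trajProb π (D i)) * F D

end EpisodicMDP

/-- The total variation distance of two mass functions on `S × A`. -/
def tvDist (p q : S → A → ℝ) : ℝ := (1 / 2) * ∑ s, ∑ a, |p s a - q s a|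

/-- `π` plays the expert's action `πE t s` with probability one at every time `t` and state `s`
such that `s` is visited at time `t` in one of the first `⌊N / 2⌋` trajectories of `D`. -/
def MimicsFirstHalf (πE : DetPolicy S A T) (D : Dataset S A T N) (π : RandPolicy S A T) : Prop :=
  ∀ i : Fin N, (i : ℕ) < N / 2 → ∀ t : Fin (T + 1), π.prob t (D i t).1 (πE t (D i t).1) = 1

/-- Every action recorded in `D` is the one that `πE` plays. -/
def PlayedBy (πE : DetPolicy S A T) (D : Dataset S A T N) : Prop :=
  ∀ i t, (D i t).2 = πE t (D i t).1

end

/-! The first half of the data fixes a partial policy `κ`. Except on an event of small probability,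
every state whose action remains unknown has expert probability at most `δ`, of order log(NH)/N, at
its time. Fix such a `κ` and let `t₁` be the last time with an unknown action. All actions after
`t₁` are known, so up to O(`δ`) the terminal law is a function of the state law at `t₁`. One of the
three states is unknown there, hence rare, so that law is governed by a single number p, the
probability of one known state (`abs_lastExp_sub_le`). It remains to pick, from the second half, a
policy extending `κ` that rarely visits unknown states at `t₁` and whose probability of the known
state has mean close to p.

Mixtures of policies are policies (`exists_mixture`), so every value in the feasible interval [-h',
h] is attained up to `δ`. An unbiased estimate of p that stays in this interval would therefore
suffice. The empirical frequency may leave it, and clipping would introduce bias. `exists_estimator`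
uses the known transitions instead. With a Lagrange multiplier λ for the rarity constraint and the
optimal value m of the reward f - λu, the performance difference identity makes m + λu - regret an
unbiased estimate. The regret is nonnegative on expert trajectories and m lies below h by a multiple
of λδ, so the sample mean exceeds h only if unknown states are visited unusually often. The
fluctuations of the regret are controlled by its own mean (`trajExp_exp_regret_le`), so a deviation
proportional to the width h + h' ≥ δ is exponentially unlikely in Nδ.

The same construction for -f respects the other end. In `exists_matching` one part of the second
half selects the end and an independent part supplies the estimate: independence keeps it unbiased,
and the selection keeps it inside the interval at both ends. -/

noncomputable section

set_option linter.unusedSectionVars false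

variable {S A : Type} [Fintype S] [DecidableEq S] [Fintype A] [DecidableEq A] {T N : ℕ}

/-! ### Expectations over independent samples -/

/-- The expectation of `F` over independent samples, each with mass function `w`. -/
def prodExp {ι X : Type} [Fintype ι] [DecidableEq ι] [Fintype X] (w : X → ℝ)
    (F : (ι → X) → ℝ) : ℝ :=
  ∑ D : ι → X, (∏ i, w (D i)) * F D

namespace prodExp

variable {ι X : Type} [Fintype ι] [DecidableEq ι] [Fintype X] {w : X → ℝ}

theorem weight_nonneg (hw : ∀ x, 0 ≤ w x) (D : ι → X) : 0 ≤ ∏ i, w (D i) :=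
  Finset.prod_nonneg fun _ _ => hw _

theorem prod_apply (f : ι → X → ℝ) :
    prodExp w (fun D : ι → X => ∏ i, f i (D i)) = ∏ i, ∑ x, w x * f i x := by
  simp only [prodExp, ← Finset.prod_mul_distrib]
  exact (Fintype.prod_sum (fun i x => w x * f i x)).symm

theorem const (hw1 : ∑ x, w x = 1) (c : ℝ) : prodExp w (fun _ : ι → X => c) = c := by
  have h := prod_apply (ι := ι) (w := w) (fun _ _ => 1)
  simp only [Finset.prod_const_one, mul_one, hw1] at h
  simp only [prodExp, mul_one] at h
  simp [prodExp, ← Finset.sum_mul, h]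

theorem add (F G : (ι → X) → ℝ) :
    prodExp w (fun D => F D + G D) = prodExp w F + prodExp w G := by
  simp [prodExp, mul_add, Finset.sum_add_distrib]

theorem sub (F G : (ι → X) → ℝ) :
    prodExp w (fun D => F D - G D) = prodExp w F - prodExp w G := by
  simp [prodExp, mul_sub, Finset.sum_sub_distrib]

theorem const_mul (c : ℝ) (F : (ι → X) → ℝ) :
    prodExp w (fun D => c * F D) = c * prodExp w F := by
  simp only [prodExp, Finset.mul_sum]
  exact Finset.sum_congr rfl fun D _ => by ring

theorem finset_sum {κ : Type} (s : Finset κ) (F : κ → (ι → X) → ℝ) :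
    prodExp w (fun D => ∑ k ∈ s, F k D) = ∑ k ∈ s, prodExp w (F k) := by
  simp only [prodExp, Finset.mul_sum]
  exact Finset.sum_comm

/-- Samples of weight zero may be ignored. This matters because several bounds hold only for
datasets whose actions are the expert's. -/
theorem mono' (hw : ∀ x, 0 ≤ w x) {F G : (ι → X) → ℝ}
    (h : ∀ D, (∏ i, w (D i)) ≠ 0 → F D ≤ G D) : prodExp w F ≤ prodExp w G := by
  refine Finset.sum_le_sum fun D _ => ?_
  rcases eq_or_ne (∏ i, w (D i)) 0 with h0 | h0
  · simp [h0]
  · exact mul_le_mul_of_nonneg_left (h D h0) (weight_nonneg hw D)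

theorem mono (hw : ∀ x, 0 ≤ w x) {F G : (ι → X) → ℝ} (h : ∀ D, F D ≤ G D) :
    prodExp w F ≤ prodExp w G := mono' hw fun D _ => h D

theorem abs_le (hw : ∀ x, 0 ≤ w x) (F : (ι → X) → ℝ) :
    |prodExp w F| ≤ prodExp w (fun D => |F D|) := by
  refine (Finset.abs_sum_le_sum_abs _ _).trans (le_of_eq (Finset.sum_congr rfl fun D _ => ?_))
  rw [abs_mul, abs_of_nonneg (weight_nonneg hw D)]

/-- The product weight factors over the coordinates satisfying `p` and the rest. The redundant
coordinates of `D` and `D'` sum out to one, so both samples can be indexed by the full `ι`. -/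
theorem split_pred (p : ι → Prop) [DecidablePred p] (hw1 : ∑ x, w x = 1)
    (F : (ι → X) → ℝ) :
    prodExp w F =
      prodExp w (fun D => prodExp w (fun D' => F (fun i => if p i then D i else D' i))) := by
  let e := Equiv.piEquivPiSubtypeProd p (fun _ : ι => X)
  have hsum : ∀ (q : ι → Prop) [DecidablePred q],
      ∑ y : {i // q i} → X, ∏ i, w (y i) = 1 := by
    intro q _
    rw [← Fintype.prod_sum (fun (_ : {i // q i}) x => w x)]
    simp [hw1]
  have hprod : ∀ (y : {i // p i} → X) (z : {i // ¬ p i} → X),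
      ∏ i, w (e.symm (y, z) i) = (∏ i, w (y i)) * ∏ i, w (z i) := by
    intro y z
    rw [← Fintype.prod_subtype_mul_prod_subtype p]
    congr 1
    · refine Finset.prod_congr rfl fun i _ => ?_
      simp [e, Equiv.piEquivPiSubtypeProd, i.2]
    · refine Finset.prod_congr rfl fun i _ => ?_
      simp [e, Equiv.piEquivPiSubtypeProd, i.2]
  have hpw : ∀ y z y' z', (fun i => if p i then e.symm (y, z) i else e.symm (y', z') i) =
      e.symm (y, z') := by
    intro y z y' z'
    funext i
    by_cases hi : p i <;> simp [e, Equiv.piEquivPiSubtypeProd, hi]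
  have key : ∀ G : (ι → X) → ℝ, prodExp w G =
      ∑ y, ∑ z, (∏ i, w (y i)) * (∏ i, w (z i)) * G (e.symm (y, z)) := by
    intro G
    unfold prodExp
    rw [← e.symm.sum_comp, Fintype.sum_prod_type]
    simp only [hprod]
  rw [key, key]
  simp only [key, hpw]
  refine Finset.sum_congr rfl fun y _ => ?_
  have h1 : ∑ y' : {i // p i} → X, ∑ z' : {i // ¬ p i} → X,
      (∏ i, w (y' i)) * (∏ i, w (z' i)) * F (e.symm (y, z')) =
      ∑ z' : {i // ¬ p i} → X, (∏ i, w (z' i)) * F (e.symm (y, z')) := by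
    simp only [mul_assoc, ← Finset.mul_sum, ← Finset.sum_mul]
    rw [hsum, one_mul]
  simp only [h1]
  simp only [mul_assoc, ← Finset.mul_sum, ← Finset.sum_mul]
  rw [hsum, one_mul]

/-- Fubini: the coordinates in `J` may be sampled independently of the others. -/
theorem split (J : Finset ι) (hw1 : ∑ x, w x = 1) (F : (ι → X) → ℝ) :
    prodExp w F = prodExp w (fun D => prodExp w (fun D' => F (J.piecewise D D'))) :=
  split_pred (· ∈ J) hw1 F

theorem apply (hw1 : ∑ x, w x = 1) (i : ι) (f : X → ℝ) :
    prodExp w (fun D : ι → X => f (D i)) = ∑ x, w x * f x := by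
  have h := prod_apply (ι := ι) (w := w) (fun j x => if j = i then f x else 1)
  have h2 : (fun D : ι → X => ∏ j, (if j = i then f (D j) else 1)) = fun D => f (D i) := by
    funext D; simp
  rw [h2] at h
  rw [h, Finset.prod_eq_single i]
  · simp
  · intro j _ hj; simp [hj, hw1]
  · simp

/-- A function of the coordinates in `J` is independent of any other coordinate. -/
theorem mul_apply (hw1 : ∑ x, w x = 1) {J : Finset ι} {g : (ι → X) → ℝ}
    (hg : ∀ D D', (∀ i ∈ J, D i = D' i) → g D = g D') {i : ι} (hi : i ∉ J) (f : X → ℝ) :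
    prodExp w (fun D => g D * f (D i)) = prodExp w g * ∑ x, w x * f x := by
  rw [split J hw1]
  have h1 : ∀ D D' : ι → X, g (J.piecewise D D') = g D := fun D D' =>
    hg _ _ fun j hj => by simp [hj]
  simp only [h1, const_mul, Finset.piecewise_eq_of_notMem _ _ _ hi, apply hw1]
  simp only [mul_comm _ (∑ x, w x * f x), const_mul]

/-- The Chernoff bound. -/
theorem chernoff (hw : ∀ x, 0 ≤ w x) (hw1 : ∑ x, w x = 1) (I : Finset ι) (f : X → ℝ)
    {b c : ℝ} (hb : ∑ x, w x * Real.exp (f x) ≤ Real.exp b) (p : (ι → X) → Prop)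
    [DecidablePred p] (hp : ∀ D, p D → c ≤ ∑ i ∈ I, f (D i)) :
    prodExp w (fun D => if p D then 1 else 0) ≤ Real.exp (I.card * b - c) := by
  have h1 : prodExp w (fun D : ι → X => if p D then (1 : ℝ) else 0) ≤
      prodExp w (fun D => Real.exp (-c) *
        ∏ i, if i ∈ I then Real.exp (f (D i)) else 1) := by
    refine mono hw fun D => ?_
    have h2 : (∏ i, if i ∈ I then Real.exp (f (D i)) else 1) =
        Real.exp (∑ i ∈ I, f (D i)) := by
      rw [Real.exp_sum]; simp
    rw [h2, ← Real.exp_add]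
    split_ifs with h
    · exact Real.one_le_exp (by linarith [hp D h])
    · positivity
  refine h1.trans ?_
  rw [const_mul, prod_apply (fun i x => if i ∈ I then Real.exp (f x) else 1)]
  have h3 : ∏ i, ∑ x, w x * (if i ∈ I then Real.exp (f x) else 1) ≤ Real.exp b ^ I.card := by
    have : ∀ i, ∑ x, w x * (if i ∈ I then Real.exp (f x) else 1) =
        if i ∈ I then ∑ x, w x * Real.exp (f x) else 1 := by
      intro i; split_ifs <;> simp [hw1]
    simp only [this]
    rw [Finset.prod_ite_mem, Finset.univ_inter, Finset.prod_const]
    exact pow_le_pow_left₀ (Finset.sum_nonneg fun x _ => mul_nonneg (hw x) (Real.exp_nonneg _)) hb _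
  calc _ ≤ Real.exp (-c) * Real.exp b ^ I.card :=
        mul_le_mul_of_nonneg_left h3 (Real.exp_nonneg _)
    _ = _ := by rw [← Real.exp_nat_mul, ← Real.exp_add]; ring_nf

end prodExp

/-! ### The law of a trajectory -/

/-- The policy restricted to all times but the last. -/
def RandPolicy.trunc (π : RandPolicy S A (T + 1)) : RandPolicy S A T where
  prob t := π.prob t.castSucc
  prob_nonneg t := π.prob_nonneg t.castSucc
  prob_sum t := π.prob_sum t.castSucc

namespace EpisodicMDP

/-- The MDP restricted to all times but the last. -/
def trunc (M : EpisodicMDP S A (T + 1)) : EpisodicMDP S A T where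
  ρ := M.ρ
  P t := M.P t.castSucc
  ρ_nonneg := M.ρ_nonneg
  ρ_sum := M.ρ_sum
  P_nonneg t := M.P_nonneg t.castSucc
  P_sum t := M.P_sum t.castSucc

/-- The expectation of a function of the trajectory under the policy `π`. -/
def trajExp (M : EpisodicMDP S A T) (π : RandPolicy S A T) (F : Traj S A T → ℝ) : ℝ :=
  ∑ τ, M.trajProb π τ * F τ

theorem trajProb_nonneg (M : EpisodicMDP S A T) (π : RandPolicy S A T) (τ : Traj S A T) :
    0 ≤ M.trajProb π τ :=
  mul_nonneg (mul_nonneg (M.ρ_nonneg _) (Finset.prod_nonneg fun _ _ => M.P_nonneg _ _ _ _))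
    (Finset.prod_nonneg fun _ _ => π.prob_nonneg _ _ _)

theorem trajProb_snoc (M : EpisodicMDP S A (T + 1)) (π : RandPolicy S A (T + 1))
    (τ : Traj S A T) (x : S × A) :
    M.trajProb π (Fin.snoc (α := fun _ => S × A) τ x) = M.trunc.trajProb π.trunc τ *
      (M.P (Fin.last T) (τ (Fin.last T)).1 (τ (Fin.last T)).2 x.1 *
        π.prob (Fin.last (T + 1)) x.1 x.2) := by
  have h0 : (Fin.snoc (α := fun _ => S × A) τ x : Traj S A (T + 1)) 0 = τ 0 := by
    rw [← Fin.castSucc_zero, Fin.snoc_castSucc (α := fun _ => S × A)]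
  have h1 : (Fin.snoc (α := fun _ => S × A) τ x : Traj S A (T + 1)) (Fin.last T).succ = x := by
    rw [Fin.succ_last, Fin.snoc_last (α := fun _ => S × A)]
  unfold trajProb
  rw [Fin.prod_univ_castSucc, Fin.prod_univ_castSucc (n := T + 1)]
  simp only [Fin.snoc_castSucc (α := fun _ => S × A), Fin.snoc_last (α := fun _ => S × A), h0, h1,
    Fin.succ_castSucc]
  simp only [trunc, RandPolicy.trunc]
  ring

/-- Peeling off the last step turns statements about trajectory laws into inductions on the horizon.
-/
theorem trajExp_succ (M : EpisodicMDP S A (T + 1)) (π : RandPolicy S A (T + 1))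
    (F : Traj S A (T + 1) → ℝ) :
    M.trajExp π F = M.trunc.trajExp π.trunc (fun τ => ∑ s',
      M.P (Fin.last T) (τ (Fin.last T)).1 (τ (Fin.last T)).2 s' *
        ∑ a, π.prob (Fin.last (T + 1)) s' a *
          F (Fin.snoc (α := fun _ => S × A) τ (s', a))) := by
  unfold trajExp
  rw [← (Fin.snocEquiv (fun _ : Fin (T + 1 + 1) => S × A)).sum_comp, Fintype.sum_prod_type,
    Finset.sum_comm]
  refine Finset.sum_congr rfl fun τ _ => ?_
  rw [Fintype.sum_prod_type, Finset.mul_sum]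
  refine Finset.sum_congr rfl fun s' _ => ?_
  rw [← mul_assoc, Finset.mul_sum]
  refine Finset.sum_congr rfl fun a _ => ?_
  have := M.trajProb_snoc π τ (s', a)
  simp only [Fin.snocEquiv, Equiv.coe_fn_mk]
  rw [this]
  ring

theorem trajExp_zero (M : EpisodicMDP S A 0) (π : RandPolicy S A 0) (F : Traj S A 0 → ℝ) :
    M.trajExp π F = ∑ s, M.ρ s * ∑ a, π.prob 0 s a * F (fun _ => (s, a)) := by
  unfold trajExp
  rw [← (Equiv.funUnique (Fin 1) (S × A)).symm.sum_comp, Fintype.sum_prod_type]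
  refine Finset.sum_congr rfl fun s _ => ?_
  rw [Finset.mul_sum]
  refine Finset.sum_congr rfl fun a _ => ?_
  simp only [trajProb, Equiv.funUnique_symm_apply, Finset.univ_eq_empty, Finset.prod_empty,
    uniqueElim_const]
  have : (uniqueElim (s, a) : Fin 1 → S × A) = fun _ => (s, a) := by
    funext i; simp
  simp [mul_assoc, this]

theorem trajExp_mono (M : EpisodicMDP S A T) (π : RandPolicy S A T) {F G : Traj S A T → ℝ}
    (h : ∀ τ, F τ ≤ G τ) : M.trajExp π F ≤ M.trajExp π G :=
  Finset.sum_le_sum fun τ _ => mul_le_mul_of_nonneg_left (h τ) (M.trajProb_nonneg π τ)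

theorem trajExp_add (M : EpisodicMDP S A T) (π : RandPolicy S A T) (F G : Traj S A T → ℝ) :
    M.trajExp π (fun τ => F τ + G τ) = M.trajExp π F + M.trajExp π G := by
  simp [trajExp, mul_add, Finset.sum_add_distrib]

theorem trajExp_sub (M : EpisodicMDP S A T) (π : RandPolicy S A T) (F G : Traj S A T → ℝ) :
    M.trajExp π (fun τ => F τ - G τ) = M.trajExp π F - M.trajExp π G := by
  simp [trajExp, mul_sub, Finset.sum_sub_distrib]

theorem trajExp_const_mul (M : EpisodicMDP S A T) (π : RandPolicy S A T) (c : ℝ)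
    (F : Traj S A T → ℝ) : M.trajExp π (fun τ => c * F τ) = c * M.trajExp π F := by
  simp only [trajExp, Finset.mul_sum]
  exact Finset.sum_congr rfl fun D _ => by ring

theorem trajExp_sum {κ : Type} (M : EpisodicMDP S A T) (π : RandPolicy S A T) (s : Finset κ)
    (F : κ → Traj S A T → ℝ) :
    M.trajExp π (fun τ => ∑ k ∈ s, F k τ) = ∑ k ∈ s, M.trajExp π (F k) := by
  simp only [trajExp, Finset.mul_sum]
  exact Finset.sum_comm

/-- The state at time `0` has law `ρ`. -/
theorem trajExp_state_zero (M : EpisodicMDP S A T) (π : RandPolicy S A T) (f : S → ℝ) :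
    M.trajExp π (fun τ => f (τ 0).1) = ∑ s, M.ρ s * f s := by
  induction T with
  | zero => rw [trajExp_zero]; simp [← Finset.sum_mul, π.prob_sum]
  | succ T ih =>
    rw [trajExp_succ]
    have h0 : ∀ (τ : Traj S A T) x,
        (Fin.snoc (α := fun _ => S × A) τ x : Traj S A (T + 1)) 0 = τ 0 := by
      intro τ x
      rw [← Fin.castSucc_zero, Fin.snoc_castSucc (α := fun _ => S × A)]
    simp only [h0, ← Finset.sum_mul, π.prob_sum, one_mul, M.P_sum]
    exact ih M.trunc π.trunc

theorem trajExp_one (M : EpisodicMDP S A T) (π : RandPolicy S A T) (c : ℝ) :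
    M.trajExp π (fun _ => c) = c := by
  have := M.trajExp_state_zero π (fun _ => c)
  rw [this, ← Finset.sum_mul, M.ρ_sum, one_mul]

theorem sum_trajProb (M : EpisodicMDP S A T) (π : RandPolicy S A T) :
    ∑ τ, M.trajProb π τ = 1 := by
  simpa [trajExp] using M.trajExp_one π 1

theorem trajExp_castSucc (M : EpisodicMDP S A (T + 1)) (π : RandPolicy S A (T + 1))
    (t : Fin (T + 1)) (f : S × A → ℝ) :
    M.trajExp π (fun τ => f (τ t.castSucc)) = M.trunc.trajExp π.trunc (fun τ => f (τ t)) := by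
  rw [trajExp_succ]
  simp only [Fin.snoc_castSucc (α := fun _ => S × A), ← Finset.sum_mul, π.prob_sum, one_mul,
    M.P_sum]

/-- Given the state at time `t`, the action has law `π_t(· | s)`. -/
theorem trajExp_action (M : EpisodicMDP S A T) (π : RandPolicy S A T) (t : Fin (T + 1))
    (f : S × A → ℝ) :
    M.trajExp π (fun τ => f (τ t)) =
      M.trajExp π (fun τ => ∑ a, π.prob t (τ t).1 a * f ((τ t).1, a)) := by
  induction T with
  | zero =>
    obtain rfl : t = 0 := Fin.fin_one_eq_zero t
    simp only [trajExp_zero]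
    refine Finset.sum_congr rfl fun s _ => ?_
    rw [← Finset.sum_mul, π.prob_sum, one_mul]
  | succ T ih =>
    cases t using Fin.lastCases with
    | last =>
      rw [trajExp_succ, trajExp_succ]
      simp only [Fin.snoc_last (α := fun _ => S × A)]
      simp only [← Finset.sum_mul, π.prob_sum, one_mul]
    | cast t =>
      rw [trajExp_castSucc]
      rw [M.trajExp_castSucc π t (fun x => ∑ a, π.prob t.castSucc x.1 a * f (x.1, a))]
      exact ih M.trunc π.trunc t

/-- Given the state and the action at time `t`, the next state has law `P_t(· | s, a)`. -/
theorem trajExp_state_succ (M : EpisodicMDP S A T) (π : RandPolicy S A T) (t : Fin T)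
    (f : S → ℝ) :
    M.trajExp π (fun τ => f (τ t.succ).1) =
      M.trajExp π (fun τ => ∑ s', M.P t (τ t.castSucc).1 (τ t.castSucc).2 s' * f s') := by
  induction T with
  | zero => exact t.elim0
  | succ T ih =>
    rw [M.trajExp_castSucc π t (fun x => ∑ s', M.P t x.1 x.2 s' * f s')]
    cases t using Fin.lastCases with
    | last =>
      rw [trajExp_succ]
      simp only [Fin.succ_last, Fin.snoc_last (α := fun _ => S × A), ← Finset.sum_mul, π.prob_sum,
        one_mul]
    | cast t =>
      rw [Fin.succ_castSucc, M.trajExp_castSucc π t.succ (fun x => f x.1)]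
      exact ih M.trunc π.trunc t

/-- A backward recursive bound for the expectation of a product over time. -/
theorem trajExp_prod_le (M : EpisodicMDP S A T) (π : RandPolicy S A T)
    (φ : Fin T → S → A → ℝ) (W : Fin (T + 1) → S → ℝ) (hφ : ∀ t s a, 0 ≤ φ t s a)
    (hW : ∀ s, 1 ≤ W (Fin.last T) s)
    (hstep : ∀ t s, ∑ a, π.prob t.castSucc s a *
      (φ t s a * ∑ s', M.P t s a s' * W t.succ s') ≤ W t.castSucc s) :
    M.trajExp π (fun τ => ∏ t : Fin T, φ t (τ t.castSucc).1 (τ t.castSucc).2) ≤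
      ∑ s, M.ρ s * W 0 s := by
  -- A terminal factor `f` is carried along so that the induction closes: the peeled last step is
  -- absorbed into the `f` of the shorter horizon.
  suffices h : ∀ f : S × A → ℝ, (∀ s, ∑ a, π.prob (Fin.last T) s a * f (s, a) ≤
      W (Fin.last T) s) → M.trajExp π (fun τ =>
        (∏ t : Fin T, φ t (τ t.castSucc).1 (τ t.castSucc).2) * f (τ (Fin.last T))) ≤
      ∑ s, M.ρ s * W 0 s by
    have h1 := h (fun _ => 1) (fun s => by simpa [π.prob_sum] using hW s)
    simpa using h1
  clear hW
  induction T with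
  | zero =>
    intro f hf
    rw [trajExp_zero]
    simp only [Finset.univ_eq_empty, Finset.prod_empty, one_mul]
    exact Finset.sum_le_sum fun s _ => mul_le_mul_of_nonneg_left (hf s) (M.ρ_nonneg s)
  | succ T ih =>
    intro f hf
    rw [trajExp_succ]
    simp only [Fin.prod_univ_castSucc, Fin.snoc_castSucc (α := fun _ => S × A),
      Fin.snoc_last (α := fun _ => S × A)]
    refine le_trans (le_of_eq ?_) (ih M.trunc π.trunc (fun t => φ t.castSucc)
      (fun t => W t.castSucc) (fun t => hφ _) (fun t s => ?_)
      (fun x => φ (Fin.last T) x.1 x.2 * ∑ s', M.P (Fin.last T) x.1 x.2 s' *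
        ∑ a, π.prob (Fin.last (T + 1)) s' a * f (s', a)) (fun s => ?_))
    · refine Finset.sum_congr rfl fun τ _ => ?_
      congr 1
      beta_reduce
      rw [← mul_assoc, Finset.mul_sum]
      refine Finset.sum_congr rfl fun s' _ => ?_
      simp only [Finset.mul_sum]
      exact Finset.sum_congr rfl fun a _ => by ring
    · exact hstep t.castSucc s
    · refine le_trans (Finset.sum_le_sum fun a _ => ?_) (hstep (Fin.last T) s)
      refine mul_le_mul_of_nonneg_left (mul_le_mul_of_nonneg_left
        (Finset.sum_le_sum fun s' _ => ?_) (hφ _ _ _)) (π.prob_nonneg _ _ _)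
      exact mul_le_mul_of_nonneg_left (hf s') (M.P_nonneg _ _ _ _)

/-! ### State distributions -/

/-- `Pr_π(s_t = s)`. -/
def stateDist (M : EpisodicMDP S A T) (π : RandPolicy S A T) (t : Fin (T + 1)) (s : S) : ℝ :=
  M.trajExp π (fun τ => if (τ t).1 = s then 1 else 0)

theorem stateDist_nonneg (M : EpisodicMDP S A T) (π : RandPolicy S A T) (t : Fin (T + 1))
    (s : S) : 0 ≤ M.stateDist π t s :=
  Finset.sum_nonneg fun τ _ => mul_nonneg (M.trajProb_nonneg π τ) (by beta_reduce; split_ifs <;> norm_num)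

theorem trajExp_state (M : EpisodicMDP S A T) (π : RandPolicy S A T) (t : Fin (T + 1))
    (f : S → ℝ) : M.trajExp π (fun τ => f (τ t).1) = ∑ s, M.stateDist π t s * f s := by
  have : (fun τ : Traj S A T => f (τ t).1) =
      fun τ => ∑ s, f s * (if (τ t).1 = s then 1 else 0) := by
    funext τ; simp
  rw [this, trajExp_sum]
  simp only [trajExp_const_mul, stateDist, mul_comm]

theorem trajExp_state_action (M : EpisodicMDP S A T) (π : RandPolicy S A T) (t : Fin (T + 1))
    (f : S × A → ℝ) : M.trajExp π (fun τ => f (τ t)) =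
      ∑ s, M.stateDist π t s * ∑ a, π.prob t s a * f (s, a) := by
  rw [trajExp_action, ← M.trajExp_state π t (fun s => ∑ a, π.prob t s a * f (s, a))]

theorem sum_stateDist (M : EpisodicMDP S A T) (π : RandPolicy S A T) (t : Fin (T + 1)) :
    ∑ s, M.stateDist π t s = 1 := by
  have := M.trajExp_state π t (fun _ => 1)
  rw [trajExp_one] at this
  simpa using this.symm

theorem stateDist_zero (M : EpisodicMDP S A T) (π : RandPolicy S A T) (s : S) :
    M.stateDist π 0 s = M.ρ s := by
  rw [stateDist, M.trajExp_state_zero π (fun s' => if s' = s then 1 else 0)]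
  simp

theorem sum_stateDist_succ_mul (M : EpisodicMDP S A T) (π : RandPolicy S A T) (t : Fin T)
    (f : S → ℝ) : ∑ s', M.stateDist π t.succ s' * f s' =
      ∑ s, M.stateDist π t.castSucc s *
        ∑ a, π.prob t.castSucc s a * ∑ s', M.P t s a s' * f s' := by
  rw [← trajExp_state, trajExp_state_succ,
    M.trajExp_state_action π t.castSucc (fun x => ∑ s', M.P t x.1 x.2 s' * f s')]

theorem stateDist_succ (M : EpisodicMDP S A T) (π : RandPolicy S A T) (t : Fin T) (s' : S) :
    M.stateDist π t.succ s' =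
      ∑ s, M.stateDist π t.castSucc s * ∑ a, π.prob t.castSucc s a * M.P t s a s' := by
  have := M.sum_stateDist_succ_mul π t (fun x => if x = s' then 1 else 0)
  simpa using this

theorem occ_eq (M : EpisodicMDP S A T) (π : RandPolicy S A T) (t : Fin (T + 1)) (s : S) (a : A) :
    M.occ π t s a = M.stateDist π t s * π.prob t s a := by
  have h1 : M.occ π t s a = M.trajExp π (fun τ => if τ t = (s, a) then 1 else 0) := by
    simp [occ, trajExp]
  rw [h1, M.trajExp_state_action π t (fun x => if x = (s, a) then 1 else 0)]
  rw [Finset.sum_eq_single s]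
  · simp
  · intro s' _ hs'; simp [hs']
  · simp

/-- `J_r(π)` as a sum over states and actions at the last time, for a terminal reward. -/
theorem value_of_terminal (M : EpisodicMDP S A T) (π : RandPolicy S A T)
    (r : Fin (T + 1) → S → A → ℝ) (hr : ∀ t s a, t ≠ Fin.last T → r t s a = 0) :
    M.value r π = M.trajExp π (fun τ => r (Fin.last T) (τ (Fin.last T)).1
      (τ (Fin.last T)).2) := by
  unfold value trajExp
  refine Finset.sum_congr rfl fun τ _ => ?_
  congr 1
  exact Finset.sum_eq_single _ (fun t _ ht => hr t _ _ ht) (by simp)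

end EpisodicMDP

/-! ### Policies with prescribed actions -/

/-- A partial specification of a deterministic policy: `κ t s = none` means that the action at
time `t` in state `s` is not prescribed. -/
abbrev PartialPolicy (S A : Type) (T : ℕ) := Fin (T + 1) → S → Option A

/-- `π` plays the prescribed actions with probability one. -/
def RandPolicy.Extends (π : RandPolicy S A T) (κ : PartialPolicy S A T) : Prop :=
  ∀ t s a, κ t s = some a → π.prob t s a = 1

/-- The deterministic policy `π` plays the prescribed actions. -/
def DetPolicy.Extends (π : DetPolicy S A T) (κ : PartialPolicy S A T) : Prop :=
  ∀ t s a, κ t s = some a → π t s = a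

theorem DetPolicy.Extends.toRand {π : DetPolicy S A T} {κ : PartialPolicy S A T}
    (h : DetPolicy.Extends π κ) : π.toRand.Extends κ := by
  intro t s a ha
  simp [DetPolicy.toRand, h t s a ha]

theorem RandPolicy.Extends.prob_eq {π : RandPolicy S A T} {κ : PartialPolicy S A T}
    (h : π.Extends κ) {t : Fin (T + 1)} {s : S} {a : A} (ha : κ t s = some a) (b : A) :
    π.prob t s b = if b = a then 1 else 0 := by
  split_ifs with hb
  · rw [hb]; exact h t s a ha
  · have h1 := π.prob_sum t s
    rw [← Finset.add_sum_erase _ _ (Finset.mem_univ a), h t s a ha] at h1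
    have h2 : ∑ x ∈ Finset.univ.erase a, π.prob t s x = 0 := by linarith
    exact (Finset.sum_eq_zero_iff_of_nonneg fun x _ => π.prob_nonneg t s x).1 h2 b
      (Finset.mem_erase.2 ⟨hb, Finset.mem_univ b⟩)

namespace EpisodicMDP

/-- A mixture of two policies is realized by a Markov policy. -/
theorem exists_mixture (M : EpisodicMDP S A T) {κ : PartialPolicy S A T}
    {π₁ π₂ : RandPolicy S A T} (h₁ : π₁.Extends κ) (h₂ : π₂.Extends κ) {c : ℝ} (hc0 : 0 ≤ c)
    (hc1 : c ≤ 1) : ∃ π : RandPolicy S A T, π.Extends κ ∧ ∀ t s, M.stateDist π t s =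
      c * M.stateDist π₁ t s + (1 - c) * M.stateDist π₂ t s := by
  set d₁ := M.stateDist π₁ with hd₁
  set d₂ := M.stateDist π₂ with hd₂
  have n₁ : ∀ t s, 0 ≤ c * d₁ t s := fun t s => mul_nonneg hc0 (M.stateDist_nonneg _ _ _)
  have n₂ : ∀ t s, 0 ≤ (1 - c) * d₂ t s := fun t s =>
    mul_nonneg (by linarith) (M.stateDist_nonneg _ _ _)
  -- The conditional law of the action given the state, under the mixture of the two trajectory
  -- laws. In states of mass zero any choice extending `κ` would do.
  let q : Fin (T + 1) → S → A → ℝ := fun t s a =>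
    if c * d₁ t s + (1 - c) * d₂ t s = 0 then π₁.prob t s a else
      (c * d₁ t s * π₁.prob t s a + (1 - c) * d₂ t s * π₂.prob t s a) /
        (c * d₁ t s + (1 - c) * d₂ t s)
  have hq : ∀ t s a, (c * d₁ t s + (1 - c) * d₂ t s) * q t s a =
      c * d₁ t s * π₁.prob t s a + (1 - c) * d₂ t s * π₂.prob t s a := by
    intro t s a
    simp only [q]
    split_ifs with h
    · have e1 : c * d₁ t s = 0 := by linarith [n₁ t s, n₂ t s]
      have e2 : (1 - c) * d₂ t s = 0 := by linarith [n₁ t s, n₂ t s]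
      rw [e1, e2]; ring
    · field_simp
  let π : RandPolicy S A T :=
    { prob := q
      prob_nonneg := by
        intro t s a
        simp only [q]
        split_ifs with h
        · exact π₁.prob_nonneg t s a
        · exact div_nonneg (add_nonneg (mul_nonneg (n₁ t s) (π₁.prob_nonneg t s a))
            (mul_nonneg (n₂ t s) (π₂.prob_nonneg t s a))) (add_nonneg (n₁ t s) (n₂ t s))
      prob_sum := by
        intro t s
        simp only [q]
        split_ifs with h
        · exact π₁.prob_sum t s
        · rw [← Finset.sum_div, Finset.sum_add_distrib, ← Finset.mul_sum, ← Finset.mul_sum,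
            π₁.prob_sum, π₂.prob_sum, mul_one, mul_one, div_self h] }
  refine ⟨π, ?_, ?_⟩
  · intro t s a ha
    change q t s a = 1
    simp only [q, h₁ t s a ha, h₂ t s a ha, mul_one]
    split_ifs with h
    · rfl
    · exact div_self h
  · intro t
    induction t using Fin.induction with
    | zero => intro s; simp only [hd₁, hd₂, stateDist_zero]; ring
    | succ t ih =>
      intro s'
      simp only [hd₁, hd₂, stateDist_succ M _ t]
      rw [Finset.mul_sum, Finset.mul_sum, ← Finset.sum_add_distrib]
      refine Finset.sum_congr rfl fun s _ => ?_
      rw [ih s]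
      simp only [Finset.mul_sum, ← Finset.sum_add_distrib]
      refine Finset.sum_congr rfl fun a _ => ?_
      have := hq t.castSucc s a
      calc _ = ((c * d₁ t.castSucc s + (1 - c) * d₂ t.castSucc s) * q t.castSucc s a) *
            M.P t s a s' := by ring
        _ = _ := by rw [this]; ring

/-! ### Optimal values -/

/-- `V` is the optimal value function for the reward `g` of the state at time `t₁`, over the
policies which extend `κ`. -/
structure IsOptimalValue (M : EpisodicMDP S A T) (κ : PartialPolicy S A T) (t₁ : Fin (T + 1))
    (g : S → ℝ) (V : Fin (T + 1) → S → ℝ) : Prop where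
  eq_of_le : ∀ t, t₁ ≤ t → V t = g
  le : ∀ t : Fin T, t.castSucc < t₁ → ∀ s a, (∀ b, κ t.castSucc s = some b → a = b) →
    ∑ s', M.P t s a s' * V t.succ s' ≤ V t.castSucc s
  exists_eq : ∀ t : Fin T, t.castSucc < t₁ → ∀ s, ∃ a, (∀ b, κ t.castSucc s = some b → a = b) ∧
    V t.castSucc s = ∑ s', M.P t s a s' * V t.succ s'

theorem exists_isOptimalValue [Nonempty A] (M : EpisodicMDP S A T) (κ : PartialPolicy S A T)
    (t₁ : Fin (T + 1)) (g : S → ℝ) : ∃ V, M.IsOptimalValue κ t₁ g V := by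
  have hstep : ∀ (t : Fin T) (W : S → ℝ) (s : S), ∃ v,
      (∀ a, (∀ b, κ t.castSucc s = some b → a = b) → ∑ s', M.P t s a s' * W s' ≤ v) ∧
      ∃ a, (∀ b, κ t.castSucc s = some b → a = b) ∧ v = ∑ s', M.P t s a s' * W s' := by
    intro t W s
    have hne : (Finset.univ.filter fun a => ∀ b, κ t.castSucc s = some b → a = b).Nonempty := by
      cases h : κ t.castSucc s with
      | none => exact ⟨Classical.arbitrary A, by simp⟩
      | some a => exact ⟨a, by simp⟩
    obtain ⟨a, ha, hmax⟩ := Finset.exists_max_image _ (fun a => ∑ s', M.P t s a s' * W s') hne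
    refine ⟨_, fun b hb => hmax b (by simpa using hb), a, by simpa using ha, rfl⟩
  choose B hB1 hB2 using hstep
  let V : Fin (T + 1) → S → ℝ := fun t => Fin.reverseInduction (motive := fun _ => S → ℝ) g
    (fun t W s => if t.castSucc < t₁ then B t W s else g s) t
  have hlast : V (Fin.last T) = g := Fin.reverseInduction_last
  have hcast : ∀ t : Fin T, V t.castSucc =
      fun s => if t.castSucc < t₁ then B t (V t.succ) s else g s := fun t =>
    Fin.reverseInduction_castSucc t
  refine ⟨V, ⟨?_, ?_, ?_⟩⟩
  · intro t ht
    cases t using Fin.lastCases with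
    | last => exact hlast
    | cast t => rw [hcast]; simp [not_lt.2 ht]
  · intro t ht s a ha
    rw [hcast]
    simp only [if_pos ht]
    exact hB1 t _ s a ha
  · intro t ht s
    rw [hcast]
    simp only [if_pos ht]
    exact hB2 t _ s

theorem sum_P_mul_le (M : EpisodicMDP S A T) (t : Fin T) (s : S) (a : A) {f : S → ℝ} {c : ℝ}
    (h : ∀ s, f s ≤ c) : ∑ s', M.P t s a s' * f s' ≤ c := by
  calc _ ≤ ∑ s', M.P t s a s' * c :=
        Finset.sum_le_sum fun s' _ => mul_le_mul_of_nonneg_left (h s') (M.P_nonneg _ _ _ _)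
    _ = c := by rw [← Finset.sum_mul, M.P_sum, one_mul]

theorem le_sum_P_mul (M : EpisodicMDP S A T) (t : Fin T) (s : S) (a : A) {f : S → ℝ} {c : ℝ}
    (h : ∀ s, c ≤ f s) : c ≤ ∑ s', M.P t s a s' * f s' := by
  calc c = ∑ s', M.P t s a s' * c := by rw [← Finset.sum_mul, M.P_sum, one_mul]
    _ ≤ _ := Finset.sum_le_sum fun s' _ => mul_le_mul_of_nonneg_left (h s') (M.P_nonneg _ _ _ _)

/-- The loss of the action `a` in state `s` at time `t` relative to the value function `V`. -/
def advantage (M : EpisodicMDP S A T) (t₁ : Fin (T + 1)) (V : Fin (T + 1) → S → ℝ) (t : Fin T)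
    (s : S) (a : A) : ℝ :=
  if t.castSucc < t₁ then V t.castSucc s - ∑ s', M.P t s a s' * V t.succ s' else 0

/-- The performance difference identity. -/
theorem trajExp_sum_advantage (M : EpisodicMDP S A T) (t₁ : Fin (T + 1))
    (V : Fin (T + 1) → S → ℝ) (π : RandPolicy S A T) :
    M.trajExp π (fun τ => ∑ t : Fin T, M.advantage t₁ V t (τ t.castSucc).1 (τ t.castSucc).2) =
      ∑ s, M.ρ s * V 0 s - ∑ s, M.stateDist π t₁ s * V t₁ s := by
  rw [trajExp_sum]
  have hterm : ∀ t : Fin T, t.castSucc < t₁ →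
      M.trajExp π (fun τ => M.advantage t₁ V t (τ t.castSucc).1 (τ t.castSucc).2) =
      ∑ s, M.stateDist π t.castSucc s * V t.castSucc s -
        ∑ s, M.stateDist π t.succ s * V t.succ s := by
    intro t ht
    simp only [advantage, if_pos ht]
    rw [trajExp_sub, trajExp_state, ← trajExp_state_succ, trajExp_state]
  -- The expected advantages telescope; the partial sums up to `t` are handled by induction.
  have key : ∀ t, t ≤ t₁ → (∑ t' : Fin T, if t'.castSucc < t then
      M.trajExp π (fun τ => M.advantage t₁ V t' (τ t'.castSucc).1 (τ t'.castSucc).2) else 0) =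
      ∑ s, M.ρ s * V 0 s - ∑ s, M.stateDist π t s * V t s := by
    intro t
    induction t using Fin.induction with
    | zero => intro _; simp [stateDist_zero]
    | succ t ih =>
      intro ht
      have hlt : t.castSucc < t₁ := lt_of_lt_of_le t.castSucc_lt_succ ht
      have hsplit : ∀ (t' : Fin T) (x : ℝ), (if t'.castSucc < t.succ then x else 0) =
          (if t'.castSucc < t.castSucc then x else 0) + if t' = t then x else 0 := by
        intro t' x
        rcases lt_trichotomy t' t with h | h | h
        · have h1 : t'.castSucc < t.castSucc := h
          have h2 : t'.castSucc < t.succ := h1.trans t.castSucc_lt_succ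
          simp [h1, h2, h.ne]
        · subst h; simp [t'.castSucc_lt_succ]
        · have h1 : ¬ t'.castSucc < t.castSucc := not_lt.2 (le_of_lt h)
          have h2 : ¬ t'.castSucc < t.succ := not_lt.2 (Fin.succ_le_castSucc_iff.2 h)
          simp [h1, h2, h.ne']
      simp only [hsplit, Finset.sum_add_distrib]
      rw [ih hlt.le]
      simp only [Finset.sum_ite_eq', Finset.mem_univ, if_true]
      rw [hterm t hlt]
      ring
  rw [← key t₁ le_rfl]
  refine Finset.sum_congr rfl fun t _ => ?_
  split_ifs with h
  · rfl
  · simp only [advantage, if_neg h]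
    exact M.trajExp_one π 0

namespace IsOptimalValue

variable {M : EpisodicMDP S A T} {κ : PartialPolicy S A T} {t₁ : Fin (T + 1)} {g : S → ℝ}
  {V : Fin (T + 1) → S → ℝ}

theorem le_of_forall_le (h : M.IsOptimalValue κ t₁ g V) {c : ℝ} (hg : ∀ s, g s ≤ c)
    (t : Fin (T + 1)) (s : S) : V t s ≤ c := by
  induction t using Fin.reverseInduction generalizing s with
  | last => rw [h.eq_of_le _ (Fin.le_last _)]; exact hg s
  | cast t ih =>
    by_cases ht : t.castSucc < t₁
    · obtain ⟨a, -, ha⟩ := h.exists_eq t ht s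
      rw [ha]
      exact M.sum_P_mul_le t s a ih
    · rw [h.eq_of_le _ (not_lt.1 ht)]; exact hg s

theorem le_of_le_forall (h : M.IsOptimalValue κ t₁ g V) {c : ℝ} (hg : ∀ s, c ≤ g s)
    (t : Fin (T + 1)) (s : S) : c ≤ V t s := by
  induction t using Fin.reverseInduction generalizing s with
  | last => rw [h.eq_of_le _ (Fin.le_last _)]; exact hg s
  | cast t ih =>
    by_cases ht : t.castSucc < t₁
    · obtain ⟨a, -, ha⟩ := h.exists_eq t ht s
      rw [ha]
      exact M.le_sum_P_mul t s a ih
    · rw [h.eq_of_le _ (not_lt.1 ht)]; exact hg s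

/-- The source of one-sidedness: along a trajectory of any deterministic policy extending `κ` the
regret is a sum of nonnegative terms. -/
theorem advantage_nonneg (h : M.IsOptimalValue κ t₁ g V) (t : Fin T) (s : S) (a : A)
    (ha : ∀ b, κ t.castSucc s = some b → a = b) : 0 ≤ M.advantage t₁ V t s a := by
  unfold advantage
  split_ifs with ht
  · linarith [h.le t ht s a ha]
  · exact le_rfl

/-- The optimal value is attained. -/
theorem exists_policy [Nonempty A] (h : M.IsOptimalValue κ t₁ g V) :
    ∃ π : RandPolicy S A T, π.Extends κ ∧
      ∑ s, M.stateDist π t₁ s * g s = ∑ s, M.ρ s * V 0 s := by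
  -- Greedy actions before `t₁`; from `t₁` on any action compatible with `κ` serves.
  have hex : ∀ (t : Fin (T + 1)) (s : S), ∃ a, (∀ b, κ t s = some b → a = b) ∧
      ∀ t' : Fin T, t = t'.castSucc → t < t₁ →
        V t s = ∑ s', M.P t' s a s' * V t'.succ s' := by
    intro t s
    by_cases ht : ∃ t' : Fin T, t = t'.castSucc ∧ t < t₁
    · obtain ⟨t', rfl, hlt⟩ := ht
      obtain ⟨a, ha, hV⟩ := h.exists_eq t' hlt s
      refine ⟨a, ha, fun t'' ht'' _ => ?_⟩
      obtain rfl := Fin.castSucc_injective _ ht''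
      exact hV
    · push Not at ht
      have hno : ∀ a, ∀ t' : Fin T, t = t'.castSucc → t < t₁ →
          V t s = ∑ s', M.P t' s a s' * V t'.succ s' := fun a t' h1 h2 =>
        absurd h2 (not_lt.2 (ht t' h1))
      cases hk : κ t s with
      | none => exact ⟨Classical.arbitrary A, by simp, hno _⟩
      | some a => exact ⟨a, by simp, hno _⟩
  choose π hπ1 hπ2 using hex
  refine ⟨DetPolicy.toRand π, DetPolicy.Extends.toRand fun t s a ha => hπ1 t s a ha, ?_⟩
  have h1 := M.trajExp_sum_advantage t₁ V (DetPolicy.toRand π)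
  have h0 : M.trajExp (DetPolicy.toRand π) (fun τ => ∑ t : Fin T,
      M.advantage t₁ V t (τ t.castSucc).1 (τ t.castSucc).2) = 0 := by
    rw [trajExp_sum]
    refine Finset.sum_eq_zero fun t _ => ?_
    rw [M.trajExp_state_action _ t.castSucc (fun x => M.advantage t₁ V t x.1 x.2)]
    refine Finset.sum_eq_zero fun s _ => ?_
    simp only [DetPolicy.toRand, ite_mul, one_mul, zero_mul, Finset.sum_ite_eq', Finset.mem_univ,
      if_true]
    unfold advantage
    split_ifs with ht
    · rw [hπ2 t.castSucc s t rfl ht]; simp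
    · simp
  rw [h0, h.eq_of_le t₁ le_rfl] at h1
  linarith

end IsOptimalValue

/-! ### The value of a policy for a terminal test function -/

theorem exists_policyValue (M : EpisodicMDP S A T) (π : RandPolicy S A T) (r : S → A → ℝ) :
    ∃ V : Fin (T + 1) → S → ℝ, (∀ s, V (Fin.last T) s = ∑ a, π.prob (Fin.last T) s a * r s a) ∧
      ∀ (t : Fin T) s, V t.castSucc s =
        ∑ a, π.prob t.castSucc s a * ∑ s', M.P t s a s' * V t.succ s' := by
  refine ⟨fun t => Fin.reverseInduction (motive := fun _ => S → ℝ)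
    (fun s => ∑ a, π.prob (Fin.last T) s a * r s a)
    (fun t W s => ∑ a, π.prob t.castSucc s a * ∑ s', M.P t s a s' * W s') t, ?_, ?_⟩
  · intro s; beta_reduce; rw [Fin.reverseInduction_last]
  · intro t s; beta_reduce; rw [Fin.reverseInduction_castSucc]

theorem sum_prob_mul_mem (π : RandPolicy S A T) (t : Fin (T + 1)) (s : S) {f : A → ℝ}
    (h : ∀ a, f a ∈ Set.Icc (0 : ℝ) 1) : ∑ a, π.prob t s a * f a ∈ Set.Icc (0 : ℝ) 1 := by
  refine ⟨Finset.sum_nonneg fun a _ => mul_nonneg (π.prob_nonneg t s a) (h a).1, ?_⟩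
  calc _ ≤ ∑ a, π.prob t s a * 1 :=
        Finset.sum_le_sum fun a _ => mul_le_mul_of_nonneg_left (h a).2 (π.prob_nonneg t s a)
    _ = 1 := by simp [π.prob_sum]

/-- The expectation of a terminal test function, in terms of the state at time `t`. The values
of two policies which agree after time `t` agree in the states in which the policies agree. -/
theorem exists_value_from (M : EpisodicMDP S A T) (κ : PartialPolicy S A T) (t₁ : Fin (T + 1))
    (hκ : ∀ t s, t₁ < t → κ t s ≠ none) (r : S → A → ℝ) (hr : ∀ s a, r s a ∈ Set.Icc (0 : ℝ) 1)
    {πE : RandPolicy S A T} (hE : πE.Extends κ) :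
    ∃ v : S → ℝ, (∀ s, v s ∈ Set.Icc (0 : ℝ) 1) ∧
      M.trajExp πE (fun τ => r (τ (Fin.last T)).1 (τ (Fin.last T)).2) =
        ∑ s, M.stateDist πE t₁ s * v s ∧
      ∀ π : RandPolicy S A T, π.Extends κ →
        |M.trajExp π (fun τ => r (τ (Fin.last T)).1 (τ (Fin.last T)).2) -
          ∑ s, M.stateDist π t₁ s * v s| ≤
          ∑ s, M.stateDist π t₁ s * if κ t₁ s = none then 1 else 0 := by
  have hval : ∀ (π : RandPolicy S A T) (V : Fin (T + 1) → S → ℝ),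
      (∀ s, V (Fin.last T) s = ∑ a, π.prob (Fin.last T) s a * r s a) →
      (∀ (t : Fin T) s, V t.castSucc s =
        ∑ a, π.prob t.castSucc s a * ∑ s', M.P t s a s' * V t.succ s') →
      (∀ t, M.trajExp π (fun τ => r (τ (Fin.last T)).1 (τ (Fin.last T)).2) =
        ∑ s, M.stateDist π t s * V t s) ∧ ∀ t s, V t s ∈ Set.Icc (0 : ℝ) 1 := by
    intro π V h1 h2
    constructor
    · intro t
      induction t using Fin.reverseInduction with
      | last =>
        simp only [h1]
        exact M.trajExp_state_action π (Fin.last T) (fun x => r x.1 x.2)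
      | cast t ih =>
        simp only [h2]
        rw [ih, sum_stateDist_succ_mul]
    · intro t
      induction t using Fin.reverseInduction with
      | last => intro s; rw [h1]; exact sum_prob_mul_mem π _ s (hr s)
      | cast t ih =>
        intro s
        rw [h2]
        exact sum_prob_mul_mem π _ s fun a =>
          ⟨M.le_sum_P_mul t s a fun s' => (ih s').1, M.sum_P_mul_le t s a fun s' => (ih s').2⟩
  obtain ⟨V, hV1, hV2⟩ := M.exists_policyValue πE r
  refine ⟨V t₁, (hval πE V hV1 hV2).2 t₁, (hval πE V hV1 hV2).1 t₁, fun π hπ => ?_⟩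
  obtain ⟨W, hW1, hW2⟩ := M.exists_policyValue π r
  have hprob : ∀ t s, κ t s ≠ none → πE.prob t s = π.prob t s := by
    intro t s hs
    obtain ⟨a, ha⟩ := Option.ne_none_iff_exists'.1 hs
    funext b
    rw [hE.prob_eq ha, hπ.prob_eq ha]
  have hafter : ∀ t, (t₁ < t → ∀ s, W t s = V t s) ∧
      ∀ s, t₁ ≤ t → κ t s ≠ none → W t s = V t s := by
    intro t
    induction t using Fin.reverseInduction with
    | last =>
      have h : ∀ s, κ (Fin.last T) s ≠ none → W (Fin.last T) s = V (Fin.last T) s := by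
        intro s hs
        rw [hW1, hV1, hprob _ s hs]
      exact ⟨fun ht s => h s (hκ _ s ht), fun s _ hs => h s hs⟩
    | cast t ih =>
      have h : t₁ ≤ t.castSucc → ∀ s, κ t.castSucc s ≠ none →
          W t.castSucc s = V t.castSucc s := by
        intro ht s hs
        rw [hW2, hV2, hprob _ s hs]
        simp only [ih.1 (lt_of_le_of_lt ht t.castSucc_lt_succ)]
      exact ⟨fun ht s => h ht.le s (hκ _ s ht), fun s ht hs => h ht s hs⟩
  rw [(hval π W hW1 hW2).1 t₁, ← Finset.sum_sub_distrib]
  refine (Finset.abs_sum_le_sum_abs _ _).trans (Finset.sum_le_sum fun s _ => ?_)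
  rw [← mul_sub, abs_mul, abs_of_nonneg (M.stateDist_nonneg _ _ _)]
  refine mul_le_mul_of_nonneg_left ?_ (M.stateDist_nonneg _ _ _)
  split_ifs with h
  · have a1 := (hval π W hW1 hW2).2 t₁ s
    have a2 := (hval πE V hV1 hV2).2 t₁ s
    rw [abs_le]
    exact ⟨by linarith [a1.1, a2.2], by linarith [a1.2, a2.1]⟩
  · rw [(hafter t₁).2 s le_rfl h]; simp

end EpisodicMDP

/-! ### Exponential moments of the regret -/

/-- One step of the supermartingale bound, with `x` the regret incurred now and `y` the expected
regret to come. From 0 ≤ x ≤ B follows exp(θx) ≤ 1 + θx + θ²Bx. The remaining surplus 3θ²Bx absorbs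
the cross term because (1 + z)(1 + 4z) ≤ 5/2 for z = θB. Both signs of `θ` are needed later. -/
theorem exp_mul_one_add_le {θ B x y : ℝ} (hθ : |θ| * B ≤ 1 / 4) (hx0 : 0 ≤ x) (hxB : x ≤ B)
    (hy0 : 0 ≤ y) (hyB : y ≤ B) :
    Real.exp (θ * x) * (1 + (θ + 4 * θ ^ 2 * B) * y) ≤ 1 + (θ + 4 * θ ^ 2 * B) * (x + y) := by
  have hB : 0 ≤ B := hx0.trans hxB
  have h1 : |θ * B| ≤ 1 / 4 := by rwa [abs_mul, abs_of_nonneg hB]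
  obtain ⟨hl, hu⟩ := abs_le.1 h1
  have h2 : |θ * x| ≤ 1 := by
    rw [abs_mul, abs_of_nonneg hx0]
    nlinarith [abs_nonneg θ]
  have h3 : Real.exp (θ * x) ≤ 1 + θ * x + θ ^ 2 * B * x := by
    have := (abs_le.1 (Real.abs_exp_sub_one_sub_id_le h2)).2
    have h4 : (θ * x) ^ 2 ≤ θ ^ 2 * B * x := by
      have : θ ^ 2 * (x * x) ≤ θ ^ 2 * (B * x) :=
        mul_le_mul_of_nonneg_left (mul_le_mul_of_nonneg_right hxB hx0) (sq_nonneg θ)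
      nlinarith
    linarith
  set z := θ * B with hz
  have hθy : |θ * y| ≤ 1 / 4 := by
    rw [abs_mul, abs_of_nonneg hy0]
    exact (mul_le_mul_of_nonneg_left hyB (abs_nonneg θ)).trans hθ
  obtain ⟨hyl, hyu⟩ := abs_le.1 hθy
  have hk : (θ + 4 * θ ^ 2 * B) * y = (1 + 4 * z) * (θ * y) := by rw [hz]; ring
  have h5 : 0 ≤ 1 + (θ + 4 * θ ^ 2 * B) * y := by rw [hk]; nlinarith
  refine (mul_le_mul_of_nonneg_right h3 h5).trans ?_
  have h6 : (1 + z) * (1 + 4 * z) ≤ 5 / 2 := by nlinarith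
  have h6' : 0 ≤ (1 + z) * (1 + 4 * z) := mul_nonneg (by linarith) (by linarith)
  have h7 : θ ^ 2 * ((1 + z) * (1 + 4 * z) * y) ≤ θ ^ 2 * (3 * B) := by
    refine mul_le_mul_of_nonneg_left ?_ (sq_nonneg θ)
    nlinarith
  have h8 : 0 ≤ x * (θ ^ 2 * (3 * B) - θ ^ 2 * ((1 + z) * (1 + 4 * z) * y)) :=
    mul_nonneg hx0 (by linarith)
  have h9 : 1 + (θ + 4 * θ ^ 2 * B) * (x + y) -
      (1 + θ * x + θ ^ 2 * B * x) * (1 + (θ + 4 * θ ^ 2 * B) * y) =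
      x * (θ ^ 2 * (3 * B) - θ ^ 2 * ((1 + z) * (1 + 4 * z) * y)) := by
    rw [hz]; ring
  linarith

theorem RandPolicy.eq_of_prob {π π' : RandPolicy S A T} (h : π.prob = π'.prob) : π = π' := by
  cases π; cases π'; simp_all

namespace EpisodicMDP

/-- The total regret along a trajectory. -/
def regret (M : EpisodicMDP S A T) (t₁ : Fin (T + 1)) (V : Fin (T + 1) → S → ℝ)
    (τ : Traj S A T) : ℝ :=
  ∑ t : Fin T, M.advantage t₁ V t (τ t.castSucc).1 (τ t.castSucc).2

/-- A Bernstein-type bound whose second-order term is proportional to the mean regret, without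
dependence on the horizon. It holds because the regret increments are nonnegative and the expected
regret to come lies in [0, B] at every state. -/
theorem trajExp_exp_regret_le [Nonempty A] {M : EpisodicMDP S A T} {κ : PartialPolicy S A T}
    {t₁ : Fin (T + 1)} {g : S → ℝ} {V : Fin (T + 1) → S → ℝ} (hV : M.IsOptimalValue κ t₁ g V)
    {πE : DetPolicy S A T} (hE : DetPolicy.Extends πE κ) {l B θ : ℝ} (hl : ∀ s, l ≤ g s)
    (hB : ∀ s, g s ≤ l + B) (hθ : |θ| * B ≤ 1 / 4) :
    M.trajExp πE.toRand (fun τ => Real.exp (θ * M.regret t₁ V τ)) ≤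
      1 + (θ + 4 * θ ^ 2 * B) *
        (∑ s, M.ρ s * V 0 s - ∑ s, M.stateDist πE.toRand t₁ s * g s) := by
  -- With all actions prescribed, the optimal value is the expert's own value, so `V - W` is the
  -- expected regret to come.
  obtain ⟨W, hW⟩ := M.exists_isOptimalValue (fun t s => some (πE t s)) t₁ g
  have hWE : ∑ s, M.stateDist πE.toRand t₁ s * g s = ∑ s, M.ρ s * W 0 s := by
    obtain ⟨π, hπ, he⟩ := hW.exists_policy
    have : π = πE.toRand := by
      refine RandPolicy.eq_of_prob ?_
      funext t s b
      rw [hπ.prob_eq (κ := fun t s => some (πE t s)) rfl b]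
      rfl
    rw [← this, he]
  have hWeq : ∀ t : Fin T, t.castSucc < t₁ → ∀ s,
      W t.castSucc s = ∑ s', M.P t s (πE t.castSucc s) s' * W t.succ s' := by
    intro t ht s
    obtain ⟨a, ha, he⟩ := hW.exists_eq t ht s
    rw [he, ha _ rfl]
  have hall : ∀ (t : Fin T) s, ∀ b, κ t.castSucc s = some b → πE t.castSucc s = b :=
    fun t s b hb => hE _ _ _ hb
  have hR0 : ∀ t s, 0 ≤ V t s - W t s := by
    intro t
    induction t using Fin.reverseInduction with
    | last =>
      intro s
      rw [hV.eq_of_le _ (Fin.le_last _), hW.eq_of_le _ (Fin.le_last _), sub_self]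
    | cast t ih =>
      intro s
      by_cases ht : t.castSucc < t₁
      · rw [hWeq t ht s]
        have h1 := hV.le t ht s _ (hall t s)
        have h2 := M.le_sum_P_mul t s (πE t.castSucc s) ih
        simp only [mul_sub, Finset.sum_sub_distrib] at h2
        linarith
      · rw [hV.eq_of_le _ (not_lt.1 ht), hW.eq_of_le _ (not_lt.1 ht), sub_self]
  have hRB : ∀ t s, V t s - W t s ≤ B := fun t s => by
    linarith [hV.le_of_forall_le hB t s, hW.le_of_le_forall hl t s]
  have key := M.trajExp_prod_le πE.toRand
    (fun t s a => Real.exp (θ * M.advantage t₁ V t s a))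
    (fun t s => 1 + (θ + 4 * θ ^ 2 * B) * (V t s - W t s)) (fun _ _ _ => Real.exp_nonneg _) ?_ ?_
  · refine le_trans (le_of_eq ?_) (key.trans (le_of_eq ?_))
    · simp only [regret, Finset.mul_sum, Real.exp_sum]
    · rw [hWE]
      simp only [mul_add, mul_one, Finset.sum_add_distrib, M.ρ_sum, ← Finset.sum_sub_distrib,
        ← mul_sub, Finset.mul_sum]
      congr 1
      exact Finset.sum_congr rfl fun s _ => by ring
  · intro s
    rw [hV.eq_of_le _ (Fin.le_last _), hW.eq_of_le _ (Fin.le_last _), sub_self, mul_zero, add_zero]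
  · intro t s
    simp only [DetPolicy.toRand, ite_mul, one_mul, zero_mul, Finset.sum_ite_eq', Finset.mem_univ,
      if_true]
    have hsum : ∑ s', M.P t s (πE t.castSucc s) s' *
        (1 + (θ + 4 * θ ^ 2 * B) * (V t.succ s' - W t.succ s')) =
        1 + (θ + 4 * θ ^ 2 * B) *
          ∑ s', M.P t s (πE t.castSucc s) s' * (V t.succ s' - W t.succ s') := by
      simp only [mul_add, mul_one, Finset.sum_add_distrib, M.P_sum, Finset.mul_sum]
      congr 1
      exact Finset.sum_congr rfl fun s _ => by ring
    rw [hsum]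
    by_cases ht : t.castSucc < t₁
    · set y := ∑ s', M.P t s (πE t.castSucc s) s' * (V t.succ s' - W t.succ s') with hy
      have hy0 : 0 ≤ y := M.le_sum_P_mul t s _ (hR0 t.succ)
      have hyB : y ≤ B := M.sum_P_mul_le t s _ (hRB t.succ)
      have hx0 : 0 ≤ M.advantage t₁ V t s (πE t.castSucc s) :=
        hV.advantage_nonneg t s _ (hall t s)
      have hxy : M.advantage t₁ V t s (πE t.castSucc s) + y = V t.castSucc s - W t.castSucc s := by
        rw [hWeq t ht s, hy]
        simp only [advantage, if_pos ht, mul_sub, Finset.sum_sub_distrib]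
        ring
      have hxB : M.advantage t₁ V t s (πE t.castSucc s) ≤ B := by
        linarith [hRB t.castSucc s]
      rw [← hxy]
      exact exp_mul_one_add_le hθ hx0 hxB hy0 hyB
    · have h1 := not_lt.1 ht
      have h2 : t₁ ≤ t.succ := h1.trans t.castSucc_lt_succ.le
      simp [advantage, ht, hV.eq_of_le _ h1, hW.eq_of_le _ h1, hV.eq_of_le _ h2, hW.eq_of_le _ h2]

theorem trajProb_toRand_ne_zero {M : EpisodicMDP S A T} {πE : DetPolicy S A T} {τ : Traj S A T}
    (h : M.trajProb πE.toRand τ ≠ 0) (t : Fin (T + 1)) : (τ t).2 = πE t (τ t).1 := by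
  have h1 := Finset.prod_ne_zero_iff.1 (right_ne_zero_of_mul h) t (Finset.mem_univ t)
  by_contra hne
  exact h1 (by simp [DetPolicy.toRand, hne])

/-! ### Unbiased estimates that respect a one-sided bound -/

/-- The expectation of `f` at time `t` under the policy `π`. -/
def stateExp (M : EpisodicMDP S A T) (π : RandPolicy S A T) (t : Fin (T + 1)) (f : S → ℝ) : ℝ :=
  ∑ s, M.stateDist π t s * f s

theorem stateExp_le (M : EpisodicMDP S A T) (π : RandPolicy S A T) (t : Fin (T + 1))
    {f : S → ℝ} {c : ℝ} (h : ∀ s, f s ≤ c) : M.stateExp π t f ≤ c := by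
  calc _ ≤ ∑ s, M.stateDist π t s * c :=
        Finset.sum_le_sum fun s _ => mul_le_mul_of_nonneg_left (h s) (M.stateDist_nonneg _ _ _)
    _ = c := by rw [← Finset.sum_mul, sum_stateDist, one_mul]

theorem le_stateExp (M : EpisodicMDP S A T) (π : RandPolicy S A T) (t : Fin (T + 1))
    {f : S → ℝ} {c : ℝ} (h : ∀ s, c ≤ f s) : c ≤ M.stateExp π t f := by
  calc c = ∑ s, M.stateDist π t s * c := by rw [← Finset.sum_mul, sum_stateDist, one_mul]
    _ ≤ _ := Finset.sum_le_sum fun s _ => mul_le_mul_of_nonneg_left (h s) (M.stateDist_nonneg _ _ _)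

theorem stateExp_mixture {M : EpisodicMDP S A T} {π π₁ π₂ : RandPolicy S A T} {c : ℝ}
    (h : ∀ t s, M.stateDist π t s = c * M.stateDist π₁ t s + (1 - c) * M.stateDist π₂ t s)
    (t : Fin (T + 1)) (f : S → ℝ) :
    M.stateExp π t f = c * M.stateExp π₁ t f + (1 - c) * M.stateExp π₂ t f := by
  simp only [stateExp, h, Finset.mul_sum, ← Finset.sum_add_distrib]
  exact Finset.sum_congr rfl fun s _ => by ring

/-- A Lagrange multiplier for the constraint that the expectation of `u` is at most `c`. -/
theorem exists_multiplier (M : EpisodicMDP S A T) (κ : PartialPolicy S A T) (t₁ : Fin (T + 1))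
    (f u : S → ℝ) {c h : ℝ} {π₀ : RandPolicy S A T} (hπ₀ : π₀.Extends κ)
    (hu₀ : M.stateExp π₀ t₁ u < c)
    (hh : ∀ π : RandPolicy S A T, π.Extends κ → M.stateExp π t₁ u ≤ c → M.stateExp π t₁ f ≤ h) :
    ∃ lam : ℝ, 0 ≤ lam ∧ ∀ π : RandPolicy S A T, π.Extends κ →
      M.stateExp π t₁ f - lam * M.stateExp π t₁ u ≤ h - lam * c := by
  -- The attainable pairs form a convex set by `exists_mixture`. It misses the open quadrant of
  -- larger `f` and smaller `u`, and the separating functional yields the multiplier.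
  let K : Set (ℝ × ℝ) :=
    {z | ∃ π : RandPolicy S A T, π.Extends κ ∧ z = (M.stateExp π t₁ f, M.stateExp π t₁ u)}
  have hK : Convex ℝ K := by
    rintro _ ⟨π₁, h₁, rfl⟩ _ ⟨π₂, h₂, rfl⟩ a b ha hb hab
    obtain ⟨π, hπ, hd⟩ := M.exists_mixture h₁ h₂ ha (by linarith)
    refine ⟨π, hπ, ?_⟩
    have hb' : b = 1 - a := by linarith
    rw [stateExp_mixture hd, stateExp_mixture hd, hb']
    simp
  have hO : Convex ℝ (Set.Ioi h ×ˢ Set.Iio c) := (convex_Ioi h).prod (convex_Iio c)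
  have hOo : IsOpen (Set.Ioi h ×ˢ Set.Iio c) := isOpen_Ioi.prod isOpen_Iio
  have hdisj : Disjoint (Set.Ioi h ×ˢ Set.Iio c) K := by
    rw [Set.disjoint_left]
    rintro _ ⟨h1, h2⟩ ⟨π, hπ, rfl⟩
    exact absurd (hh π hπ (le_of_lt h2)) (not_le.2 h1)
  obtain ⟨F, d, hF1, hF2⟩ := geometric_hahn_banach_open hO hOo hK hdisj
  set α := F (1, 0) with hα
  set β := F (0, 1) with hβ
  have hF : ∀ x y, F (x, y) = α * x + β * y := by
    intro x y
    have : ((x, y) : ℝ × ℝ) = x • (1, 0) + y • (0, 1) := by simp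
    rw [this, map_add, map_smul, map_smul]
    simp [mul_comm, hα, hβ]
  have hin : ∀ x y, h < x → y < c → α * x + β * y < d := fun x y hx hy => by
    rw [← hF]; exact hF1 _ ⟨hx, hy⟩
  have hout : ∀ π : RandPolicy S A T, π.Extends κ →
      d ≤ α * M.stateExp π t₁ f + β * M.stateExp π t₁ u := fun π hπ => by
    rw [← hF]; exact hF2 _ ⟨π, hπ, rfl⟩
  have hlim : α * h + β * c ≤ d := by
    refine le_of_forall_pos_le_add fun ε hε => ?_
    have hpos : 0 < |α| + |β| + 1 := by positivity
    have h1 := hin (h + ε / (|α| + |β| + 1)) (c - ε / (|α| + |β| + 1))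
      (by linarith [div_pos hε hpos]) (by linarith [div_pos hε hpos])
    have h2 : (|α| + |β| + 1) * (ε / (|α| + |β| + 1)) = ε := by field_simp
    have hε' : 0 < ε / (|α| + |β| + 1) := div_pos hε hpos
    nlinarith [neg_abs_le α, le_abs_self β, mul_le_mul_of_nonneg_right (neg_abs_le α) hε'.le,
      mul_le_mul_of_nonneg_right (le_abs_self β) hε'.le]
  have hα0 : α ≤ 0 := by
    by_contra hpos
    push Not at hpos
    have h1 := hin (h + 1 + |(d - α * (h + 1) - β * (c - 1)) / α|) (c - 1)
      (by linarith [abs_nonneg ((d - α * (h + 1) - β * (c - 1)) / α)]) (by linarith)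
    have h2 := mul_le_mul_of_nonneg_left (le_abs_self ((d - α * (h + 1) - β * (c - 1)) / α)) hpos.le
    rw [mul_div_cancel₀ _ hpos.ne'] at h2
    nlinarith
  have hβ0 : 0 ≤ β := by
    by_contra hneg
    push Not at hneg
    have h1 := hin (h + 1) (c - 1 - |(d - α * (h + 1) - β * (c - 1)) / β|)
      (by linarith) (by linarith [abs_nonneg ((d - α * (h + 1) - β * (c - 1)) / β)])
    have h2 := mul_le_mul_of_nonpos_left
      (neg_le_of_abs_le (le_refl |(d - α * (h + 1) - β * (c - 1)) / β|)) hneg.le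
    rw [mul_div_cancel₀ _ hneg.ne] at h2
    nlinarith
  -- Slater's condition: the strictly feasible `π₀` rules out a separating line that ignores `f`.
  have hαne : α ≠ 0 := by
    intro h0
    have h1 := hout π₀ hπ₀
    rw [h0] at h1 hlim hin
    rcases hβ0.eq_or_lt with hb | hb
    · have := hin (h + 1) (c - 1) (by linarith) (by linarith)
      rw [← hb] at this h1
      linarith
    · nlinarith
  have hαneg : α < 0 := lt_of_le_of_ne hα0 hαne
  refine ⟨β / (-α), div_nonneg hβ0 (by linarith), fun π hπ => ?_⟩
  have h1 := hout π hπ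
  have h2 : -α * (M.stateExp π t₁ f - β / (-α) * M.stateExp π t₁ u) ≤
      -α * (h - β / (-α) * c) := by
    have e : ∀ x y : ℝ, -α * (x - β / (-α) * y) = -(α * x + β * y) := by
      intro x y; field_simp; ring
    rw [e, e]; linarith
  exact le_of_mul_le_mul_left h2 (by linarith)

end EpisodicMDP

/-- The mean of `F` over the samples with index in `I`. -/
def sampleMean {ι X : Type} (I : Finset ι) (F : X → ℝ) (D : ι → X) : ℝ :=
  (∑ i ∈ I, F (D i)) / I.card

namespace EpisodicMDP

theorem abs_advantage_le {M : EpisodicMDP S A T} {t₁ : Fin (T + 1)} {V : Fin (T + 1) → S → ℝ}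
    {l B : ℝ} (hB : 0 ≤ B) (h1 : ∀ t s, l ≤ V t s) (h2 : ∀ t s, V t s ≤ l + B) (t : Fin T) (s : S)
    (a : A) : |M.advantage t₁ V t s a| ≤ B := by
  unfold advantage
  split_ifs
  · have := M.le_sum_P_mul t s a (h1 t.succ)
    have := M.sum_P_mul_le t s a (h2 t.succ)
    rw [abs_le]
    constructor <;> linarith [h1 t.castSucc s, h2 t.castSucc s]
  · simpa using hB

/-- The tail bounds for the regret and for the visits at time `t₁`, with deviations
proportional to `w`. -/
theorem prodExp_regret_deviation_le [Nonempty A] {M : EpisodicMDP S A T} {κ : PartialPolicy S A T}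
    {t₁ : Fin (T + 1)} {g : S → ℝ} {V : Fin (T + 1) → S → ℝ} (hV : M.IsOptimalValue κ t₁ g V)
    {πE : DetPolicy S A T} (hE : DetPolicy.Extends πE κ) {l B R w : ℝ} (hB0 : 0 < B)
    (hl : ∀ s, l ≤ g s) (hB : ∀ s, g s ≤ l + B)
    (hR : R = ∑ s, M.ρ s * V 0 s - ∑ s, M.stateDist πE.toRand t₁ s * g s)
    (hRw : R ≤ w) (I : Finset (Fin N)) (p : Dataset S A T N → Prop) [DecidablePred p]
    (hp : (∀ D, p D → I.card * (R + w / 8) ≤ ∑ i ∈ I, M.regret t₁ V (D i)) ∨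
      ∀ D, p D → ∑ i ∈ I, M.regret t₁ V (D i) ≤ I.card * (R - w / 8)) :
    prodExp (M.trajProb πE.toRand) (fun D => if p D then 1 else 0) ≤
      Real.exp (-(I.card * (w / (1024 * B)))) := by
  have hn : (0 : ℝ) ≤ I.card := Nat.cast_nonneg _
  -- For θ = ±1/(64B) the deviation `w / 8` gains w/(512B) in the exponent. The second-order term
  -- 4θ²BR costs at most w/(1024B), which is half of it.
  have main : ∀ θ : ℝ, θ ^ 2 = (1 / (64 * B)) ^ 2 →
      (∀ D, p D → I.card * (θ * R + w / (512 * B)) ≤ ∑ i ∈ I, θ * M.regret t₁ V (D i)) →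
      prodExp (M.trajProb πE.toRand) (fun D => if p D then 1 else 0) ≤
        Real.exp (-(I.card * (w / (1024 * B)))) := by
    intro θ hθ hD
    have habs : |θ| = 1 / (64 * B) := by
      rw [← abs_of_nonneg (show (0 : ℝ) ≤ 1 / (64 * B) by positivity)]
      exact (sq_eq_sq_iff_abs_eq_abs _ _).1 hθ
    have h1 := trajExp_exp_regret_le hV hE hl hB (θ := θ) (by
      rw [habs]; rw [div_mul_eq_mul_div, div_le_div_iff₀ (by positivity) (by norm_num)]; linarith)
    rw [← hR] at h1
    have h2 : ∑ τ, M.trajProb πE.toRand τ * Real.exp (θ * M.regret t₁ V τ) ≤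
        Real.exp ((θ + 4 * θ ^ 2 * B) * R) :=
      h1.trans (by linarith [Real.add_one_le_exp ((θ + 4 * θ ^ 2 * B) * R)])
    refine (prodExp.chernoff (M.trajProb_nonneg _) (M.sum_trajProb _) I _ h2 p hD).trans ?_
    refine Real.exp_le_exp.2 ?_
    have h3 : 4 * θ ^ 2 * B = 1 / (1024 * B) := by rw [hθ]; field_simp; norm_num
    rw [h3]
    have h4 : 1 / (1024 * B) * R ≤ 1 / (1024 * B) * w :=
      mul_le_mul_of_nonneg_left hRw (by positivity)
    have h5 : w / (512 * B) = 2 * (w / (1024 * B)) := by field_simp; ring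
    have h6 : 1 / (1024 * B) * w = w / (1024 * B) := by ring
    have h7 : (I.card : ℝ) * ((θ + 1 / (1024 * B)) * R) - I.card * (θ * R + w / (512 * B)) =
        I.card * (1 / (1024 * B) * R - w / (512 * B)) := by ring
    rw [h7, ← mul_neg]
    exact mul_le_mul_of_nonneg_left (by linarith) hn
  rcases hp with hp | hp
  · refine main (1 / (64 * B)) rfl fun D hD => ?_
    rw [← Finset.mul_sum]
    have := mul_le_mul_of_nonneg_left (hp D hD) (show (0 : ℝ) ≤ 1 / (64 * B) by positivity)
    refine le_trans (le_of_eq ?_) this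
    field_simp; ring
  · refine main (-(1 / (64 * B))) (by ring) fun D hD => ?_
    rw [← Finset.mul_sum]
    have := mul_le_mul_of_nonneg_left (hp D hD) (show (0 : ℝ) ≤ 1 / (64 * B) by positivity)
    refine le_trans (le_of_eq ?_) ((neg_le_neg this).trans (le_of_eq (neg_mul _ _).symm))
    field_simp; ring

/-- Chernoff at exponent one: since e ≤ 3, the exponential moment is at most exp(2δ), and the
threshold 4δ leaves 2δ. -/
theorem prodExp_visits_le {M : EpisodicMDP S A T} {π : RandPolicy S A T} {t₁ : Fin (T + 1)}
    {q : S → Prop} [DecidablePred q] {δ : ℝ}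
    (hu : M.stateExp π t₁ (fun s => if q s then 1 else 0) ≤ δ) (I : Finset (Fin N))
    (p : Dataset S A T N → Prop) [DecidablePred p]
    (hp : ∀ D, p D → I.card * (4 * δ) ≤ ∑ i ∈ I, if q (D i t₁).1 then (1 : ℝ) else 0) :
    prodExp (M.trajProb π) (fun D => if p D then 1 else 0) ≤ Real.exp (-(I.card * (2 * δ))) := by
  have h1 : ∑ τ : Traj S A T, M.trajProb π τ *
      Real.exp (if q (τ t₁).1 then (1 : ℝ) else 0) ≤ Real.exp (2 * δ) := by
    calc _ ≤ M.trajExp π (fun τ => 1 + 2 * (if q (τ t₁).1 then (1 : ℝ) else 0)) := by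
          refine M.trajExp_mono π fun τ => ?_
          split_ifs
          · have := Real.exp_one_lt_d9; norm_num; linarith
          · simp
      _ = 1 + 2 * M.stateExp π t₁ (fun s => if q s then 1 else 0) := by
          rw [trajExp_add, trajExp_one, trajExp_const_mul,
            M.trajExp_state π t₁ (fun s => if q s then (1 : ℝ) else 0), stateExp]
      _ ≤ _ := by linarith [Real.add_one_le_exp (2 * δ)]
  refine (prodExp.chernoff (M.trajProb_nonneg _) (M.sum_trajProb _) I _ h1 p hp).trans ?_
  exact Real.exp_le_exp.2 (le_of_eq (by ring))

/-- Let `h` bound the expectation of `f` at time `t₁` over the policies which extend `κ` and visit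
`q` at time `t₁` with probability at most `33 δ`. There is an estimate of this expectation which
is unbiased for every deterministic policy that visits `q` with probability at most `δ`, such that
the sample mean exceeds `h` with exponentially small probability only. -/
theorem exists_estimator [Nonempty A] (M : EpisodicMDP S A T) (κ : PartialPolicy S A T)
    (t₁ : Fin (T + 1)) (f : S → ℝ) (hf : ∀ s, |f s| ≤ 1) (q : S → Prop) [DecidablePred q]
    {δ h : ℝ} (hδ : 0 < δ) {π₀ : RandPolicy S A T} (hπ₀ : π₀.Extends κ)
    (hu₀ : M.stateExp π₀ t₁ (fun s => if q s then 1 else 0) ≤ δ)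
    (hh : ∀ π : RandPolicy S A T, π.Extends κ →
      M.stateExp π t₁ (fun s => if q s then 1 else 0) ≤ 33 * δ → M.stateExp π t₁ f ≤ h)
    (hh1 : h ≤ 1) :
    ∃ F : Traj S A T → ℝ, (∀ τ, |F τ| ≤ (T + 2) * (2 + 1 / δ)) ∧
      ∀ πE : DetPolicy S A T, DetPolicy.Extends πE κ →
        M.stateExp πE.toRand t₁ (fun s => if q s then 1 else 0) ≤ δ →
        M.trajExp πE.toRand F = M.stateExp πE.toRand t₁ f ∧
        ∀ w, δ ≤ w → h - M.stateExp πE.toRand t₁ f ≤ w →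
        ∀ {N : ℕ} (I : Finset (Fin N)), I.Nonempty →
          ∀ (p : Dataset S A T N → Prop) [DecidablePred p],
          (∀ D, p D → ¬ (sampleMean I F D ≤ h ∧
            |sampleMean I F D - M.stateExp πE.toRand t₁ f| ≤ w / 4)) →
          prodExp (M.trajProb πE.toRand) (fun D => if p D then 1 else 0) ≤
            3 * Real.exp (-(I.card * (δ / 3072))) := by
  set u : S → ℝ := fun s => if q s then 1 else 0 with hu
  have hu01 : ∀ s, 0 ≤ u s ∧ u s ≤ 1 := by
    intro s; simp only [hu]; split_ifs <;> norm_num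
  obtain ⟨lam, hlam, hmult⟩ := M.exists_multiplier κ t₁ f u (c := 33 * δ) (h := h) hπ₀
    (by linarith) hh
  obtain ⟨V, hV⟩ := M.exists_isOptimalValue κ t₁ (fun s => f s - lam * u s)
  have hgl : ∀ s, -(1 + lam) ≤ f s - lam * u s := by
    intro s
    have := (abs_le.1 (hf s)).1
    nlinarith [hu01 s]
  have hgB : ∀ s, f s - lam * u s ≤ -(1 + lam) + (2 + lam) := by
    intro s
    have := (abs_le.1 (hf s)).2
    nlinarith [hu01 s]
  set m := ∑ s, M.ρ s * V 0 s with hm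
  have hgexp : ∀ π, ∑ s, M.stateDist π t₁ s * (f s - lam * u s) =
      M.stateExp π t₁ f - lam * M.stateExp π t₁ u := by
    intro π
    simp only [stateExp, Finset.mul_sum, ← Finset.sum_sub_distrib]
    exact Finset.sum_congr rfl fun s _ => by ring
  have hmh : m ≤ h - lam * (33 * δ) := by
    obtain ⟨π, hπ, he⟩ := hV.exists_policy
    rw [hgexp] at he
    rw [hm, ← he]
    exact hmult π hπ
  have hlamle : lam ≤ 1 / δ := by
    have h1 := hmult π₀ hπ₀
    have h2 := M.le_stateExp π₀ t₁ (f := f) (c := -1) fun s => (abs_le.1 (hf s)).1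
    rw [le_div_iff₀ hδ]
    nlinarith
  have hm1 : |m| ≤ 1 + lam := by
    have e : ∀ c : ℝ, ∑ s, M.ρ s * c = c := fun c => by rw [← Finset.sum_mul, M.ρ_sum, one_mul]
    rw [abs_le]
    constructor
    · rw [← e (-(1 + lam))]
      exact Finset.sum_le_sum fun s _ =>
        mul_le_mul_of_nonneg_left (hV.le_of_le_forall hgl 0 s) (M.ρ_nonneg s)
    · rw [← e (1 + lam)]
      refine Finset.sum_le_sum fun s _ => mul_le_mul_of_nonneg_left ?_ (M.ρ_nonneg s)
      linarith [hV.le_of_forall_le hgB 0 s]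
  refine ⟨fun τ => m + lam * u (τ t₁).1 - M.regret t₁ V τ, fun τ => ?_, fun πE hE huE => ?_⟩
  · have h1 : |M.regret t₁ V τ| ≤ T * (2 + lam) := by
      refine (Finset.abs_sum_le_sum_abs _ _).trans ?_
      refine (Finset.sum_le_card_nsmul _ _ (2 + lam) fun t _ => ?_).trans (le_of_eq (by simp [mul_add]))
      exact abs_advantage_le (by linarith) (hV.le_of_le_forall hgl) (hV.le_of_forall_le hgB) _ _ _
    have h2 : |lam * u (τ t₁).1| ≤ lam := by
      rw [abs_of_nonneg (mul_nonneg hlam (hu01 _).1)]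
      nlinarith [hu01 (τ t₁).1]
    calc _ ≤ |m + lam * u (τ t₁).1| + |M.regret t₁ V τ| := abs_sub _ _
      _ ≤ |m| + |lam * u (τ t₁).1| + |M.regret t₁ V τ| := by gcongr; exact abs_add_le _ _
      _ ≤ (T + 2) * (2 + lam) := by linarith
      _ ≤ _ := by gcongr
  set pf := M.stateExp πE.toRand t₁ f with hpf
  set pu := M.stateExp πE.toRand t₁ u with hpu
  set R := m - (pf - lam * pu) with hR
  have hRreg : M.trajExp πE.toRand (M.regret t₁ V) = R := by
    rw [hR, hpf, hpu, ← hgexp]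
    have := M.trajExp_sum_advantage t₁ V πE.toRand
    rw [hV.eq_of_le t₁ le_rfl] at this
    exact this
  refine ⟨?_, fun w hδw hw N I hI p _ hp => ?_⟩
  · rw [trajExp_sub, hRreg, trajExp_add, trajExp_one, trajExp_const_mul, trajExp_state]
    change m + lam * pu - R = pf
    rw [hR]; ring
  have hpu0 : 0 ≤ pu := M.le_stateExp _ _ fun s => (hu01 s).1
  have hw0 : 0 < w := hδ.trans_le hδw
  -- The multiplier inequality at the expert, whose visit probability is at most δ, gives 32·lam·δ ≤
  -- h - pf.
  have hlw : lam * (32 * δ) ≤ w := by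
    have h1 := hmult πE.toRand hE.toRand
    nlinarith
  have hRw : R ≤ w := by
    have : lam * pu ≤ lam * (33 * δ) := mul_le_mul_of_nonneg_left (by linarith) hlam
    linarith
  have hn : (0 : ℝ) < I.card := by exact_mod_cast hI.card_pos
  have hRdef : R = ∑ s, M.ρ s * V 0 s -
      ∑ s, M.stateDist πE.toRand t₁ s * (f s - lam * u s) := by rw [hgexp]
  have b1 := prodExp_regret_deviation_le hV hE (B := 2 + lam) (by linarith) hgl hgB hRdef hRw
    I (fun D => I.card * (R + w / 8) ≤ ∑ i ∈ I, M.regret t₁ V (D i)) (Or.inl fun D h => h)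
  have b2 := prodExp_regret_deviation_le hV hE (B := 2 + lam) (by linarith) hgl hgB hRdef hRw
    I (fun D => ∑ i ∈ I, M.regret t₁ V (D i) ≤ I.card * (R - w / 8)) (Or.inr fun D h => h)
  have b3 := prodExp_visits_le (q := q) huE I
    (fun D => I.card * (4 * δ) ≤ ∑ i ∈ I, if q (D i t₁).1 then (1 : ℝ) else 0) fun D h => h
  have hexp : δ / 3072 ≤ w / (1024 * (2 + lam)) := by
    rw [div_le_div_iff₀ (by norm_num) (by positivity)]
    nlinarith
  have e1 : Real.exp (-(I.card * (w / (1024 * (2 + lam))))) ≤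
      Real.exp (-(I.card * (δ / 3072))) :=
    Real.exp_le_exp.2 (neg_le_neg (mul_le_mul_of_nonneg_left hexp hn.le))
  have e3 : Real.exp (-(I.card * (2 * δ))) ≤ Real.exp (-(I.card * (δ / 3072))) :=
    Real.exp_le_exp.2 (neg_le_neg (mul_le_mul_of_nonneg_left (by linarith) hn.le))
  refine le_trans ?_ (show _ ≤ _ from (add_le_add (add_le_add (b1.trans e1) (b2.trans e1))
    (b3.trans e3)).trans (le_of_eq (by ring)))
  rw [← prodExp.add, ← prodExp.add]
  refine prodExp.mono' (M.trajProb_nonneg _) fun D hD => ?_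
  have hnn : ∀ (a : Prop) [Decidable a], (0 : ℝ) ≤ if a then 1 else 0 := by
    intro a _; split_ifs <;> norm_num
  by_cases hpD : p D
  swap
  · rw [if_neg hpD]
    exact add_nonneg (add_nonneg (hnn _) (hnn _)) (hnn _)
  rw [if_pos hpD]
  by_contra hlt
  push Not at hlt
  have n1 : ¬ (I.card * (R + w / 8) ≤ ∑ i ∈ I, M.regret t₁ V (D i)) := fun h1 => by
    rw [if_pos h1] at hlt
    linarith [hnn (∑ i ∈ I, M.regret t₁ V (D i) ≤ I.card * (R - w / 8)),
      hnn (I.card * (4 * δ) ≤ ∑ i ∈ I, if q (D i t₁).1 then (1 : ℝ) else 0)]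
  have n2 : ¬ (∑ i ∈ I, M.regret t₁ V (D i) ≤ I.card * (R - w / 8)) := fun h1 => by
    rw [if_pos h1] at hlt
    linarith [hnn (I.card * (R + w / 8) ≤ ∑ i ∈ I, M.regret t₁ V (D i)),
      hnn (I.card * (4 * δ) ≤ ∑ i ∈ I, if q (D i t₁).1 then (1 : ℝ) else 0)]
  have n3 : ¬ (I.card * (4 * δ) ≤ ∑ i ∈ I, if q (D i t₁).1 then (1 : ℝ) else 0) := fun h1 => by
    rw [if_pos h1] at hlt
    linarith [hnn (I.card * (R + w / 8) ≤ ∑ i ∈ I, M.regret t₁ V (D i)),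
      hnn (∑ i ∈ I, M.regret t₁ V (D i) ≤ I.card * (R - w / 8))]
  push Not at n1 n2 n3
  refine hp D hpD ?_
  set Z := (∑ i ∈ I, M.regret t₁ V (D i)) / I.card with hZ
  set Y := (∑ i ∈ I, u (D i t₁).1) / I.card with hY
  have hmean : sampleMean I (fun τ => m + lam * u (τ t₁).1 - M.regret t₁ V τ) D =
      m + lam * Y - Z := by
    simp only [sampleMean, hZ, hY, Finset.sum_sub_distrib, Finset.sum_add_distrib,
      Finset.sum_const, nsmul_eq_mul, ← Finset.mul_sum]
    field_simp
  have z1 : Z < R + w / 8 := by rw [hZ, div_lt_iff₀ hn]; linarith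
  have z2 : R - w / 8 < Z := by rw [hZ, lt_div_iff₀ hn]; linarith
  have y1 : Y < 4 * δ := by rw [hY, div_lt_iff₀ hn]; linarith
  have y0 : 0 ≤ Y := div_nonneg (Finset.sum_nonneg fun i _ => (hu01 _).1) hn.le
  -- Positive weight forces every recorded action to be the expert's, hence compatible with `κ`.
  have z0 : 0 ≤ Z := by
    refine div_nonneg (Finset.sum_nonneg fun i _ => Finset.sum_nonneg fun t _ => ?_) hn.le
    refine hV.advantage_nonneg t _ _ fun b hb => ?_
    rw [trajProb_toRand_ne_zero (Finset.prod_ne_zero_iff.1 hD i (Finset.mem_univ i)) t.castSucc]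
    exact hE _ _ _ hb
  rw [hmean]
  have ly : lam * Y ≤ lam * (4 * δ) := mul_le_mul_of_nonneg_left y1.le hlam
  have ly0 : 0 ≤ lam * Y := mul_nonneg hlam y0
  have lp : lam * pu ≤ lam * (4 * δ) := mul_le_mul_of_nonneg_left (by linarith) hlam
  have lp0 : 0 ≤ lam * pu := mul_nonneg hlam hpu0
  have ld : 0 ≤ lam * δ := mul_nonneg hlam hδ.le
  -- Upper bound: m + 4·lam·δ ≤ h - 29·lam·δ ≤ h. For the deviation, the mean minus `pf` equals
  -- lam(Y - pu) + (R - Z), and each term is at most w/8 in absolute value.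
  refine ⟨by linarith, ?_⟩
  rw [abs_le]
  constructor <;> linarith

end EpisodicMDP

/-- Selecting an estimate by means of data disjoint from its own sample does not bias it. -/
theorem prodExp_mul_sampleMean {ι X : Type} [Fintype ι] [DecidableEq ι] [Fintype X] {w : X → ℝ}
    (hw1 : ∑ x, w x = 1) {J I : Finset ι} (hJI : Disjoint J I) (hI : I.Nonempty)
    {g : (ι → X) → ℝ} (hg : ∀ D D', (∀ i ∈ J, D i = D' i) → g D = g D') (F : X → ℝ) :
    prodExp w (fun D => g D * sampleMean I F D) = prodExp w g * ∑ x, w x * F x := by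
  have hn : (I.card : ℝ) ≠ 0 := by exact_mod_cast hI.card_pos.ne'
  have h1 : (fun D : ι → X => g D * sampleMean I F D) =
      fun D => (1 / (I.card : ℝ)) * ∑ i ∈ I, g D * F (D i) := by
    funext D
    rw [sampleMean, ← Finset.mul_sum]; ring
  rw [h1, prodExp.const_mul, prodExp.finset_sum]
  rw [Finset.sum_congr rfl fun i hi =>
    prodExp.mul_apply hw1 hg (Finset.disjoint_right.1 hJI hi) F]
  rw [Finset.sum_const, nsmul_eq_mul]
  field_simp

theorem abs_sampleMean_le {ι X : Type} (I : Finset ι) {F : X → ℝ} {c : ℝ} (hc : 0 ≤ c)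
    (hF : ∀ x, |F x| ≤ c) (D : ι → X) : |sampleMean I F D| ≤ c := by
  rw [sampleMean, abs_div, Nat.abs_cast]
  refine div_le_of_le_mul₀ (Nat.cast_nonneg _) hc ?_
  refine (Finset.abs_sum_le_sum_abs _ _).trans ?_
  refine (Finset.sum_le_card_nsmul _ _ c fun i _ => hF _).trans (le_of_eq ?_)
  rw [nsmul_eq_mul, mul_comm]

theorem exists_extends [Nonempty A] (κ : PartialPolicy S A T) :
    ∃ π : RandPolicy S A T, π.Extends κ := by
  refine ⟨DetPolicy.toRand fun t s => (κ t s).getD (Classical.arbitrary A),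
    DetPolicy.Extends.toRand fun t s a ha => ?_⟩
  simp [ha]

/-! ### Matching one expectation at a fixed time -/

namespace EpisodicMDP

theorem stateExp_neg (M : EpisodicMDP S A T) (π : RandPolicy S A T) (t : Fin (T + 1))
    (f : S → ℝ) : M.stateExp π t (fun s => -f s) = -M.stateExp π t f := by
  simp [stateExp]

theorem abs_stateExp_le (M : EpisodicMDP S A T) (π : RandPolicy S A T) (t : Fin (T + 1))
    {f : S → ℝ} {c : ℝ} (hf : ∀ s, |f s| ≤ c) : |M.stateExp π t f| ≤ c :=
  abs_le.2 ⟨M.le_stateExp π t fun s => (abs_le.1 (hf s)).1,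
    M.stateExp_le π t fun s => (abs_le.1 (hf s)).2⟩

/-- The tight upper bound for the expectation of `f` at time `t₁` over the policies which extend
`κ` and satisfy the constraint on `u`. -/
theorem exists_sup (M : EpisodicMDP S A T) {κ : PartialPolicy S A T} {t₁ : Fin (T + 1)}
    {f : S → ℝ} (hf : ∀ s, |f s| ≤ 1) {u : S → ℝ} {c : ℝ}
    (hne : ∃ π : RandPolicy S A T, π.Extends κ ∧ M.stateExp π t₁ u ≤ c) :
    ∃ h : ℝ, h ≤ 1 ∧ (∀ π : RandPolicy S A T, π.Extends κ → M.stateExp π t₁ u ≤ c →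
      M.stateExp π t₁ f ≤ h) ∧ ∀ ε > 0, ∃ π : RandPolicy S A T, π.Extends κ ∧
        M.stateExp π t₁ u ≤ c ∧ h - ε < M.stateExp π t₁ f := by
  let X : Set ℝ := {x | ∃ π : RandPolicy S A T, π.Extends κ ∧ M.stateExp π t₁ u ≤ c ∧
    M.stateExp π t₁ f = x}
  have hX : X.Nonempty := by
    obtain ⟨π, h1, h2⟩ := hne
    exact ⟨_, π, h1, h2, rfl⟩
  have hX1 : ∀ x ∈ X, x ≤ 1 := by
    rintro _ ⟨π, -, -, rfl⟩
    exact (abs_le.1 (M.abs_stateExp_le π t₁ hf)).2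
  refine ⟨sSup X, csSup_le hX hX1, fun π h1 h2 => le_csSup ⟨1, hX1⟩ ⟨π, h1, h2, rfl⟩,
    fun ε hε => ?_⟩
  obtain ⟨_, ⟨π, h1, h2, rfl⟩, hlt⟩ := exists_lt_of_lt_csSup hX (sub_lt_self (sSup X) hε)
  exact ⟨π, h1, h2, hlt⟩

/-- Policies which extend `κ`, visit `q` at time `t₁` rarely, and match the expectation of `f` at
time `t₁` with small bias. -/
theorem exists_matching [Nonempty A] (M : EpisodicMDP S A T) (κ : PartialPolicy S A T)
    (t₁ : Fin (T + 1)) (f : S → ℝ) (hf : ∀ s, |f s| ≤ 1) (q : S → Prop) [DecidablePred q]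
    {δ : ℝ} (hδ : 0 < δ) {Ia Ib : Finset (Fin N)} (hab : Disjoint Ia Ib) {n : ℝ} (hn : 0 < n)
    (ha : n ≤ Ia.card) (hb : n ≤ Ib.card) :
    ∃ e : Learner S A T N, (∀ D, (e D).Extends κ) ∧
      (∀ D D', (∀ i ∈ Ia ∪ Ib, D i = D' i) → e D = e D') ∧
      ∀ πE : DetPolicy S A T, DetPolicy.Extends πE κ →
        M.stateExp πE.toRand t₁ (fun s => if q s then 1 else 0) ≤ δ →
        (∀ D, M.stateExp (e D) t₁ (fun s => if q s then 1 else 0) ≤ 33 * δ) ∧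
        |prodExp (M.trajProb πE.toRand) (fun D => M.stateExp (e D) t₁ f) -
          M.stateExp πE.toRand t₁ f| ≤
          δ + 9 * (1 + (T + 2) * (2 + 1 / δ)) * Real.exp (-(n * (δ / 3072))) := by
  classical
  set u : S → ℝ := fun s => if q s then 1 else 0 with hu
  by_cases hex : ∃ π : RandPolicy S A T, π.Extends κ ∧ M.stateExp π t₁ u ≤ δ
  swap
  · obtain ⟨π, hπ⟩ := exists_extends (S := S) (A := A) κ
    exact ⟨fun _ => π, fun _ => hπ, fun _ _ _ => rfl, fun πE hE huE =>
      absurd ⟨_, hE.toRand, huE⟩ hex⟩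
  obtain ⟨π₀, hπ₀, hu₀⟩ := hex
  have hex33 : ∃ π : RandPolicy S A T, π.Extends κ ∧ M.stateExp π t₁ u ≤ 33 * δ :=
    ⟨π₀, hπ₀, by linarith⟩
  have hfn : ∀ s, |(fun s => -f s) s| ≤ 1 := fun s => by simpa using hf s
  obtain ⟨h, hh1, hh, hhap⟩ := M.exists_sup hf hex33
  obtain ⟨h', hh1', hh', hhap'⟩ := M.exists_sup hfn hex33
  simp only [stateExp_neg] at hh' hhap'
  have hK : 0 ≤ 9 * (1 + ((T : ℝ) + 2) * (2 + 1 / δ)) * Real.exp (-(n * (δ / 3072))) := by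
    positivity
  -- If the feasible interval is narrower than δ, any feasible policy matches and no data are used.
  rcases lt_or_ge (h + h') δ with hw | hw
  · refine ⟨fun _ => π₀, fun _ => hπ₀, fun _ _ _ => rfl, fun πE hE huE =>
      ⟨fun _ => by linarith, ?_⟩⟩
    rw [prodExp.const (M.sum_trajProb _)]
    have a1 := hh _ hE.toRand (by linarith : _ ≤ 33 * δ)
    have a2 := hh' _ hE.toRand (by linarith : _ ≤ 33 * δ)
    have a3 := hh _ hπ₀ (by linarith)
    have a4 := hh' _ hπ₀ (by linarith)
    refine le_trans ?_ (le_add_of_nonneg_right hK)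
    rw [abs_le]
    constructor <;> linarith
  obtain ⟨F, hFb, hF⟩ := M.exists_estimator κ t₁ f hf q hδ hπ₀ hu₀ hh hh1
  obtain ⟨G, hGb, hG⟩ := M.exists_estimator κ t₁ (fun s => -f s) hfn q hδ hπ₀ hu₀
    (by simpa only [stateExp_neg] using hh') hh1'
  simp only [stateExp_neg] at hG
  -- Feasible targets are hit by a near-maximizer, a near-minimizer or a mixture of the two. For
  -- other targets only feasibility of the policy is kept.
  have hpol : ∀ v : ℝ, ∃ π : RandPolicy S A T, π.Extends κ ∧ M.stateExp π t₁ u ≤ 33 * δ ∧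
      (-h' ≤ v → v ≤ h → |M.stateExp π t₁ f - v| ≤ δ) := by
    intro v
    obtain ⟨π₁, e₁, u₁, l₁⟩ := hhap δ hδ
    obtain ⟨π₂, e₂, u₂, l₂⟩ := hhap' δ hδ
    rcases le_or_gt (M.stateExp π₁ t₁ f) v with c1 | c1
    · exact ⟨π₁, e₁, u₁, fun _ _ => abs_le.2 ⟨by linarith, by linarith⟩⟩
    rcases le_or_gt v (M.stateExp π₂ t₁ f) with c2 | c2
    · exact ⟨π₂, e₂, u₂, fun _ _ => abs_le.2 ⟨by linarith, by linarith⟩⟩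
    have hlt : 0 < M.stateExp π₁ t₁ f - M.stateExp π₂ t₁ f := by linarith
    set c := (v - M.stateExp π₂ t₁ f) / (M.stateExp π₁ t₁ f - M.stateExp π₂ t₁ f) with hc
    have hc0 : 0 ≤ c := div_nonneg (by linarith) hlt.le
    have hc1 : c ≤ 1 := by rw [hc, div_le_one hlt]; linarith
    obtain ⟨π, hπ, hd⟩ := M.exists_mixture e₁ e₂ hc0 hc1
    refine ⟨π, hπ, ?_, fun _ _ => ?_⟩
    · rw [stateExp_mixture hd]; nlinarith
    · have hcm : c * (M.stateExp π₁ t₁ f - M.stateExp π₂ t₁ f) = v - M.stateExp π₂ t₁ f :=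
        div_mul_cancel₀ _ hlt.ne'
      rw [stateExp_mixture hd]
      have : c * M.stateExp π₁ t₁ f + (1 - c) * M.stateExp π₂ t₁ f - v = 0 := by linarith
      rw [this, abs_zero]; exact hδ.le
  choose pol pol1 pol2 pol3 using hpol
  -- `Ia` decides on which side of the midpoint of [-h', h] the target lies. On the upper side `F`
  -- is used, being safe at h; on the lower side -`G`, being safe at -h'. Two deviations of (h +
  -- h')/4, one for each sample, cannot carry the estimate from the midpoint past the opposite end.
  let g : Dataset S A T N → ℝ := fun D => if (h - h') / 2 ≤ sampleMean Ia F D then 1 else 0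
  let v : Dataset S A T N → ℝ := fun D =>
    if (h - h') / 2 ≤ sampleMean Ia F D then sampleMean Ib F D else -sampleMean Ib G D
  have hmean : ∀ (I : Finset (Fin N)) (H : Traj S A T → ℝ) (D D' : Dataset S A T N),
      (∀ i ∈ I, D i = D' i) → sampleMean I H D = sampleMean I H D' := by
    intro I H D D' hD
    simp only [sampleMean]
    rw [Finset.sum_congr rfl fun i hi => by rw [hD i hi]]
  refine ⟨fun D => pol (v D), fun D => pol1 _, fun D D' hD => ?_, fun πE hE huE =>
    ⟨fun D => pol2 _, ?_⟩⟩
  · have h1 : ∀ i ∈ Ia, D i = D' i := fun i hi => hD i (Finset.mem_union_left _ hi)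
    have h2 : ∀ i ∈ Ib, D i = D' i := fun i hi => hD i (Finset.mem_union_right _ hi)
    have : v D = v D' := by
      simp only [v, hmean Ia F D D' h1, hmean Ib F D D' h2, hmean Ib G D D' h2]
    simp only [this]
  set p := M.stateExp πE.toRand t₁ f with hp
  have hIa : Ia.Nonempty := Finset.card_pos.1 (by exact_mod_cast hn.trans_le ha)
  have hIb : Ib.Nonempty := Finset.card_pos.1 (by exact_mod_cast hn.trans_le hb)
  have hph : p ≤ h := hh _ hE.toRand (by linarith : _ ≤ 33 * δ)
  have hph' : -p ≤ h' := hh' _ hE.toRand (by linarith : _ ≤ 33 * δ)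
  obtain ⟨hFE, hFt⟩ := hF πE hE huE
  obtain ⟨hGE, hGt⟩ := hG πE hE huE
  have hEv : prodExp (M.trajProb πE.toRand) v = p := by
    have hg : ∀ D D', (∀ i ∈ Ia, D i = D' i) → g D = g D' := fun D D' hD => by
      simp only [g, hmean Ia F D D' hD]
    have hg' : ∀ D D', (∀ i ∈ Ia, D i = D' i) → (fun D => g D - 1) D = (fun D => g D - 1) D' :=
      fun D D' hD => by simp only [hg D D' hD]
    have hv : v = fun D => g D * sampleMean Ib F D + (g D - 1) * sampleMean Ib G D := by
      funext D
      simp only [v, g]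
      split_ifs <;> ring
    rw [hv, prodExp.add, prodExp_mul_sampleMean (M.sum_trajProb _) hab hIb hg,
      prodExp_mul_sampleMean (M.sum_trajProb _) hab hIb hg']
    have e1 : ∑ τ, M.trajProb πE.toRand τ * F τ = p := hFE
    have e2 : ∑ τ, M.trajProb πE.toRand τ * G τ = -p := hGE
    rw [e1, e2, prodExp.sub, prodExp.const (M.sum_trajProb _)]
    ring
  have tA := hFt (h + h') hw (by linarith) Ia hIa
    (fun D => ¬ (sampleMean Ia F D ≤ h ∧ |sampleMean Ia F D - p| ≤ (h + h') / 4)) fun D hD => hD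
  have tB := hFt (h + h') hw (by linarith) Ib hIb
    (fun D => ¬ (sampleMean Ib F D ≤ h ∧ |sampleMean Ib F D - p| ≤ (h + h') / 4)) fun D hD => hD
  have tC := hGt (h + h') hw (by linarith) Ib hIb
    (fun D => ¬ (sampleMean Ib G D ≤ h' ∧ |sampleMean Ib G D - -p| ≤ (h + h') / 4)) fun D hD => hD
  have hexp : ∀ I : Finset (Fin N), n ≤ I.card →
      Real.exp (-(I.card * (δ / 3072))) ≤ Real.exp (-(n * (δ / 3072))) := fun I hI =>
    Real.exp_le_exp.2 (neg_le_neg (mul_le_mul_of_nonneg_right hI (by positivity)))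
  set K : ℝ := 1 + ((T : ℝ) + 2) * (2 + 1 / δ) with hKdef
  have hK0 : 0 ≤ K := by positivity
  rw [← hEv, ← prodExp.sub]
  refine (prodExp.abs_le (M.trajProb_nonneg _) _).trans ?_
  set bA : Dataset S A T N → ℝ := fun D => if ¬ (sampleMean Ia F D ≤ h ∧
    |sampleMean Ia F D - p| ≤ (h + h') / 4) then 1 else 0 with hbA
  set bB : Dataset S A T N → ℝ := fun D => if ¬ (sampleMean Ib F D ≤ h ∧
    |sampleMean Ib F D - p| ≤ (h + h') / 4) then 1 else 0 with hbB
  set bC : Dataset S A T N → ℝ := fun D => if ¬ (sampleMean Ib G D ≤ h' ∧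
    |sampleMean Ib G D - -p| ≤ (h + h') / 4) then 1 else 0 with hbC
  -- Each of the three bad events has three tail terms, whence the factor 9; on them only the crude
  -- bound `K` is available.
  have hpt : ∀ D, |M.stateExp (pol (v D)) t₁ f - v D| ≤ δ + K * (bA D + bB D + bC D) := by
    intro D
    have n1 : 0 ≤ bA D := by simp only [hbA]; split_ifs <;> norm_num
    have n2 : 0 ≤ bB D := by simp only [hbB]; split_ifs <;> norm_num
    have n3 : 0 ≤ bC D := by simp only [hbC]; split_ifs <;> norm_num
    have hgen : |M.stateExp (pol (v D)) t₁ f - v D| ≤ K := by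
      refine (abs_sub _ _).trans (add_le_add (M.abs_stateExp_le _ t₁ hf) ?_)
      simp only [v]
      split_ifs
      · exact abs_sampleMean_le Ib (by positivity) hFb D
      · rw [abs_neg]; exact abs_sampleMean_le Ib (by positivity) hGb D
    have hbad : 1 ≤ bA D + bB D + bC D →
        |M.stateExp (pol (v D)) t₁ f - v D| ≤ δ + K * (bA D + bB D + bC D) := fun h1 => by
      nlinarith
    by_cases cA : sampleMean Ia F D ≤ h ∧ |sampleMean Ia F D - p| ≤ (h + h') / 4
    swap
    · refine hbad ?_
      have : bA D = 1 := by simp only [hbA, if_pos cA]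
      linarith
    by_cases cB : sampleMean Ib F D ≤ h ∧ |sampleMean Ib F D - p| ≤ (h + h') / 4
    swap
    · refine hbad ?_
      have : bB D = 1 := by simp only [hbB, if_pos cB]
      linarith
    by_cases cC : sampleMean Ib G D ≤ h' ∧ |sampleMean Ib G D - -p| ≤ (h + h') / 4
    swap
    · refine hbad ?_
      have : bC D = 1 := by simp only [hbC, if_pos cC]
      linarith
    have hA := abs_le.1 cA.2
    have hB := abs_le.1 cB.2
    have hC := abs_le.1 cC.2
    refine (pol3 (v D) ?_ ?_).trans (le_add_of_nonneg_right (by positivity))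
    · simp only [v]
      split_ifs with hsel
      · linarith
      · linarith [cC.1]
    · simp only [v]
      split_ifs with hsel
      · exact cB.1
      · push Not at hsel; linarith
  refine (prodExp.mono (M.trajProb_nonneg _) hpt).trans ?_
  rw [prodExp.add, prodExp.const (M.sum_trajProb _), prodExp.const_mul, prodExp.add, prodExp.add]
  have hsum := add_le_add (add_le_add (tA.trans (mul_le_mul_of_nonneg_left (hexp Ia ha) three_pos.le))
    (tB.trans (mul_le_mul_of_nonneg_left (hexp Ib hb) three_pos.le)))
    (tC.trans (mul_le_mul_of_nonneg_left (hexp Ib hb) three_pos.le))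
  have := mul_le_mul_of_nonneg_left hsum hK0
  linarith

end EpisodicMDP

/-! ### From one state probability to the law of the last state and action -/

namespace EpisodicMDP

/-- The expectation of the test function `r` of the last state and the last action. -/
def lastExp (M : EpisodicMDP S A T) (π : RandPolicy S A T) (r : S → A → ℝ) : ℝ :=
  M.trajExp π (fun τ => r (τ (Fin.last T)).1 (τ (Fin.last T)).2)

theorem lastExp_mem (M : EpisodicMDP S A T) (π : RandPolicy S A T) {r : S → A → ℝ}
    (hr : ∀ s a, r s a ∈ Set.Icc (0 : ℝ) 1) : M.lastExp π r ∈ Set.Icc (0 : ℝ) 1 := by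
  constructor
  · rw [← M.trajExp_one π 0]; exact M.trajExp_mono π fun τ => (hr _ _).1
  · rw [← M.trajExp_one π 1]; exact M.trajExp_mono π fun τ => (hr _ _).2

theorem lastExp_eq_sum_occ (M : EpisodicMDP S A T) (π : RandPolicy S A T) (r : S → A → ℝ) :
    M.lastExp π r = ∑ s, ∑ a, r s a * M.occ π (Fin.last T) s a := by
  rw [lastExp, M.trajExp_state_action π (Fin.last T) (fun x => r x.1 x.2)]
  refine Finset.sum_congr rfl fun s _ => ?_
  rw [Finset.mul_sum]
  exact Finset.sum_congr rfl fun a _ => by rw [occ_eq]; ring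

theorem abs_sub_le_one {x y : ℝ} (hx : x ∈ Set.Icc (0 : ℝ) 1) (hy : y ∈ Set.Icc (0 : ℝ) 1) :
    |x - y| ≤ 1 :=
  abs_le.2 ⟨by linarith [hx.1, hy.2], by linarith [hx.2, hy.1]⟩

theorem prodExp_mem (M : EpisodicMDP S A T) (π : RandPolicy S A T) {F : Dataset S A T N → ℝ}
    (hF : ∀ D, F D ∈ Set.Icc (0 : ℝ) 1) :
    prodExp (M.trajProb π) F ∈ Set.Icc (0 : ℝ) 1 := by
  have h0 := prodExp.mono (M.trajProb_nonneg π) fun D => (hF D).1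
  have h1 := prodExp.mono (M.trajProb_nonneg π) fun D => (hF D).2
  rw [prodExp.const (M.sum_trajProb π)] at h0 h1
  exact ⟨h0, h1⟩

/-- If the state distribution at time `t₁` is matched in one prescribed state, and states whose
action is not prescribed are visited rarely, then the law of the last state and action is matched:
of the three states, at most one is left, and its probability is the complementary one. -/
theorem abs_lastExp_sub_le (M : EpisodicMDP (Fin 3) A T) {κ : PartialPolicy (Fin 3) A T}
    {t₁ : Fin (T + 1)} (hκ : ∀ t s, t₁ < t → κ t s ≠ none) {b c : Fin 3} (hb : κ t₁ b = none)
    (hc : κ t₁ c ≠ none) {πE : RandPolicy (Fin 3) A T} (hE : πE.Extends κ)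
    {e : Learner (Fin 3) A T N} (he : ∀ D, (e D).Extends κ) {δ η : ℝ}
    (huE : M.stateExp πE t₁ (fun s => if κ t₁ s = none then 1 else 0) ≤ δ)
    (hue : ∀ D, M.stateExp (e D) t₁ (fun s => if κ t₁ s = none then 1 else 0) ≤ 33 * δ)
    (hη : |prodExp (M.trajProb πE) (fun D => M.stateExp (e D) t₁ (fun s => if s = c then 1 else 0)) -
      M.stateExp πE t₁ (fun s => if s = c then 1 else 0)| ≤ η)
    {r : Fin 3 → A → ℝ} (hr : ∀ s a, r s a ∈ Set.Icc (0 : ℝ) 1) :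
    |prodExp (M.trajProb πE) (fun D => M.lastExp (e D) r) - M.lastExp πE r| ≤ η + 67 * δ := by
  obtain ⟨v, hv, hvE, hvπ⟩ := M.exists_value_from κ t₁ hκ r hr hE
  obtain ⟨d, hd⟩ : ∃ d : Fin 3, ∀ s, s ≠ c → κ t₁ s ≠ none → s = d := by
    have hcb : c ≠ b := fun h => hc (h ▸ hb)
    have h3 : ∀ b c : Fin 3, c ≠ b → ∃ d : Fin 3, ∀ s, s ≠ c → s ≠ b → s = d := by decide
    obtain ⟨d, hd⟩ := h3 b c hcb
    exact ⟨d, fun s h1 h2 => hd s h1 fun h => h2 (h ▸ hb)⟩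
  set E : (Dataset (Fin 3) A T N → ℝ) → ℝ := prodExp (M.trajProb πE) with hEdef
  have hone := M.sum_trajProb πE
  have hnn := M.trajProb_nonneg πE
  let m : Fin 3 → ℝ := fun s => E fun D => M.stateDist (e D) t₁ s
  have hm0 : ∀ s, 0 ≤ m s := fun s => by
    have := prodExp.mono (ι := Fin N) hnn fun D => M.stateDist_nonneg (e D) t₁ s
    rwa [prodExp.const hone] at this
  have hmsum : ∀ f : Fin 3 → ℝ, E (fun D => M.stateExp (e D) t₁ f) = ∑ s, m s * f s := by
    intro f
    simp only [stateExp, hEdef, m]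
    rw [prodExp.finset_sum]
    refine Finset.sum_congr rfl fun s _ => ?_
    simp only [mul_comm _ (f s)]
    exact prodExp.const_mul (f s) fun D => M.stateDist (e D) t₁ s
  have hm1 : ∑ s, m s = 1 := by
    have := hmsum fun _ => 1
    simp only [stateExp, mul_one, sum_stateDist, hEdef, prodExp.const hone] at this
    exact this.symm
  have h1 : |E (fun D => M.lastExp (e D) r) - ∑ s, m s * v s| ≤ 33 * δ := by
    rw [← hmsum, hEdef, ← prodExp.sub]
    refine (prodExp.abs_le hnn _).trans ?_
    rw [← prodExp.const (ι := Fin N) hone (33 * δ)]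
    exact prodExp.mono hnn fun D => (hvπ (e D) (he D)).trans (hue D)
  have hmu : ∑ s, m s * (if κ t₁ s = none then 1 else 0) ≤ 33 * δ := by
    rw [← hmsum, hEdef, ← prodExp.const (ι := Fin N) hone (33 * δ)]
    exact prodExp.mono hnn hue
  have h2 : |∑ s, m s * v s - M.lastExp πE r| ≤ η + 34 * δ := by
    -- Both state laws have mass one, so `v` may be shifted by `v d`. This removes the state `d`,
    -- whose probability is not estimated.
    have e1 : ∑ s, m s * v s - M.lastExp πE r =
        ∑ s, (m s - M.stateDist πE t₁ s) * (v s - v d) := by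
      have : M.lastExp πE r = ∑ s, M.stateDist πE t₁ s * v s := hvE
      rw [this]
      simp only [sub_mul, mul_sub, Finset.sum_sub_distrib, ← Finset.sum_mul, hm1, sum_stateDist]
      ring
    have e2 : |m c - M.stateDist πE t₁ c| ≤ η := by
      rw [hmsum] at hη
      simpa [stateExp] using hη
    have e3 : ∀ s, |(m s - M.stateDist πE t₁ s) * (v s - v d)| ≤
        (if s = c then |m c - M.stateDist πE t₁ c| else 0) +
          (m s * (if κ t₁ s = none then 1 else 0) +
            M.stateDist πE t₁ s * (if κ t₁ s = none then 1 else 0)) := by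
      intro s
      have hd0 := M.stateDist_nonneg πE t₁ s
      have hv1 : |(m s - M.stateDist πE t₁ s) * (v s - v d)| ≤ |m s - M.stateDist πE t₁ s| := by
        rw [abs_mul]
        exact mul_le_of_le_one_right (abs_nonneg _) (abs_sub_le_one (hv s) (hv d))
      by_cases hs : s = c
      · subst hs
        simp only [if_true, if_neg hc, mul_zero, add_zero]
        exact hv1
      · by_cases hs' : κ t₁ s = none
        · simp only [if_neg hs, if_pos hs', mul_one, zero_add]
          refine hv1.trans (abs_le.2 ⟨?_, ?_⟩) <;> linarith [hm0 s]
        · rw [hd s hs hs']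
          have := M.stateDist_nonneg πE t₁ d
          simp only [sub_self, mul_zero, abs_zero]
          have := hm0 d
          positivity
    rw [e1]
    refine (Finset.abs_sum_le_sum_abs _ _).trans
      ((Finset.sum_le_sum fun s _ => e3 s).trans ?_)
    rw [Finset.sum_add_distrib, Finset.sum_add_distrib, Finset.sum_ite_eq']
    simp only [Finset.mem_univ, if_true]
    have : ∑ s, M.stateDist πE t₁ s * (if κ t₁ s = none then 1 else 0) ≤ δ := huE
    linarith
  have := abs_sub_le (E (fun D => M.lastExp (e D) r)) (∑ s, m s * v s) (M.lastExp πE r)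
  linarith

/-- It suffices to match one state at the last time with an unprescribed action. Up to three states
may be unprescribed there, so 3δ plays the role of δ; the coefficient is 204 = 3 · (67 + 1). -/
theorem exists_learner_of_partial [Nonempty A] (M : EpisodicMDP (Fin 3) A T)
    (κ : PartialPolicy (Fin 3) A T) {δ : ℝ} (hδ : 0 < δ) {Ia Ib : Finset (Fin N)}
    (hab : Disjoint Ia Ib) {n : ℝ} (hn : 0 < n) (ha : n ≤ Ia.card) (hb : n ≤ Ib.card) :
    ∃ e : Learner (Fin 3) A T N, (∀ D, (e D).Extends κ) ∧
      (∀ D D', (∀ i ∈ Ia ∪ Ib, D i = D' i) → e D = e D') ∧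
      ∀ πE : DetPolicy (Fin 3) A T, DetPolicy.Extends πE κ →
        (∀ t s, κ t s = none → M.stateDist πE.toRand t s ≤ δ) →
        ∀ r : Fin 3 → A → ℝ, (∀ s a, r s a ∈ Set.Icc (0 : ℝ) 1) →
        |prodExp (M.trajProb πE.toRand) (fun D => M.lastExp (e D) r) - M.lastExp πE.toRand r| ≤
          204 * δ + 9 * (1 + (T + 2) * (2 + 1 / (3 * δ))) * Real.exp (-(n * (3 * δ / 3072))) := by
  have hrest : 0 ≤ 9 * (1 + ((T : ℝ) + 2) * (2 + 1 / (3 * δ))) *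
      Real.exp (-(n * (3 * δ / 3072))) := by positivity
  obtain ⟨π, hπ⟩ := exists_extends (S := Fin 3) (A := A) κ
  by_cases hall : ∀ t s, κ t s ≠ none
  · refine ⟨fun _ => π, fun _ => hπ, fun _ _ _ => rfl, fun πE hE _ r _ => ?_⟩
    have : π = πE.toRand := by
      refine RandPolicy.eq_of_prob ?_
      funext t s b
      obtain ⟨a, ha⟩ := Option.ne_none_iff_exists'.1 (hall t s)
      rw [hπ.prob_eq ha, hE.toRand.prob_eq ha]
    rw [prodExp.const (M.sum_trajProb _), this, sub_self, abs_zero]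
    linarith
  push Not at hall
  obtain ⟨t₁, ⟨b, hb'⟩, hmax⟩ : ∃ t₁ : Fin (T + 1), (∃ s, κ t₁ s = none) ∧
      ∀ t s, t₁ < t → κ t s ≠ none := by
    have hne : (Finset.univ.filter fun t : Fin (T + 1) => ∃ s, κ t s = none).Nonempty := by
      obtain ⟨t, s, h⟩ := hall
      exact ⟨t, by simpa using ⟨s, h⟩⟩
    obtain ⟨t₁, h1, h2⟩ := Finset.exists_max_image _ id hne
    refine ⟨t₁, by simpa using h1, fun t s ht h => ?_⟩
    exact absurd (h2 t (by simpa using ⟨s, h⟩)) (not_le.2 ht)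
  have hu : ∀ πE : DetPolicy (Fin 3) A T,
      (∀ t s, κ t s = none → M.stateDist πE.toRand t s ≤ δ) →
      M.stateExp πE.toRand t₁ (fun s => if κ t₁ s = none then 1 else 0) ≤ 3 * δ := by
    intro πE h
    refine (Finset.sum_le_card_nsmul _ _ δ fun s _ => ?_).trans (le_of_eq (by simp))
    beta_reduce
    split_ifs with hs
    · rw [mul_one]; exact h t₁ s hs
    · rw [mul_zero]; exact hδ.le
  by_cases hc : ∃ c, κ t₁ c ≠ none
  swap
  -- No state is prescribed at `t₁`, so 1 ≤ 3δ and the claim is trivial.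
  · push Not at hc
    refine ⟨fun _ => π, fun _ => hπ, fun _ _ _ => rfl, fun πE hE h r hr => ?_⟩
    have h1 := hu πE h
    simp only [stateExp, hc, if_true, mul_one, sum_stateDist] at h1
    rw [prodExp.const (M.sum_trajProb _)]
    have := abs_sub_le_one (M.lastExp_mem π hr) (M.lastExp_mem πE.toRand hr)
    linarith
  obtain ⟨c, hc⟩ := hc
  obtain ⟨e, he1, he2, he3⟩ := M.exists_matching κ t₁ (fun s => if s = c then 1 else 0)
    (fun s => by split_ifs <;> simp) (fun s => κ t₁ s = none) (δ := 3 * δ) (by linarith) hab hn ha hb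
  refine ⟨e, he1, he2, fun πE hE h r hr => ?_⟩
  obtain ⟨h1, h2⟩ := he3 πE hE (hu πE h)
  have := M.abs_lastExp_sub_le hmax hb' hc hE.toRand he1 (hu πE h) h1 h2 hr
  linarith

/-! ### The learner -/

/-- The actions recorded in the first half of the dataset. -/
def firstHalf (D : Dataset S A T N) : PartialPolicy S A T := fun t s =>
  open Classical in
  if h : ∃ i : Fin N, (i : ℕ) < N / 2 ∧ (D i t).1 = s then some (D h.choose t).2 else none

theorem firstHalf_congr {D D' : Dataset S A T N} (h : ∀ i : Fin N, (i : ℕ) < N / 2 → D i = D' i) :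
    firstHalf D = firstHalf D' := by
  funext t s
  have hP : (fun i : Fin N => (i : ℕ) < N / 2 ∧ (D i t).1 = s) =
      fun i : Fin N => (i : ℕ) < N / 2 ∧ (D' i t).1 = s := by
    funext i
    by_cases hi : (i : ℕ) < N / 2
    · rw [h i hi]
    · simp [hi]
  by_cases hD : ∃ i : Fin N, (i : ℕ) < N / 2 ∧ (D i t).1 = s
  · have hD' : ∃ i : Fin N, (i : ℕ) < N / 2 ∧ (D' i t).1 = s := by rwa [← hP]
    -- The chosen index depends only on the predicate, and the two predicates coincide.
    have hch : hD.choose = hD'.choose := by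
      congr 1
    simp only [firstHalf, dif_pos hD, dif_pos hD']
    rw [hch, h _ hD'.choose_spec.1]
  · have hD' : ¬ ∃ i : Fin N, (i : ℕ) < N / 2 ∧ (D' i t).1 = s := by rwa [← hP]
    simp only [firstHalf, dif_neg hD, dif_neg hD']

theorem extends_firstHalf {πE : DetPolicy S A T} {D : Dataset S A T N} (h : PlayedBy πE D) :
    DetPolicy.Extends πE (firstHalf D) := by
  intro t s a ha
  unfold firstHalf at ha
  split_ifs at ha with hD
  · have h1 := h hD.choose t
    rw [hD.choose_spec.2] at h1
    rw [← h1]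
    exact Option.some.inj ha

theorem firstHalf_eq_some {πE : DetPolicy S A T} {D : Dataset S A T N} (h : PlayedBy πE D)
    {i : Fin N} (hi : (i : ℕ) < N / 2) (t : Fin (T + 1)) :
    firstHalf D t (D i t).1 = some (πE t (D i t).1) := by
  have hD : ∃ j : Fin N, (j : ℕ) < N / 2 ∧ (D j t).1 = (D i t).1 := ⟨i, hi, rfl⟩
  simp only [firstHalf, dif_pos hD]
  rw [h hD.choose t, hD.choose_spec.2]

theorem playedBy_of_weight_ne_zero {M : EpisodicMDP S A T} {πE : DetPolicy S A T}
    {D : Dataset S A T N} (h : ∏ i, M.trajProb πE.toRand (D i) ≠ 0) : PlayedBy πE D :=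
  fun i t => trajProb_toRand_ne_zero (Finset.prod_ne_zero_iff.1 h i (Finset.mem_univ i)) t

/-- A state of probability more than `δ` is missed by the samples in `I` with exponentially small
probability. -/
theorem prodExp_unseen_le (M : EpisodicMDP S A T) (π : RandPolicy S A T) (t : Fin (T + 1)) (s : S)
    {δ : ℝ} (hδ : δ < M.stateDist π t s) (I : Finset (Fin N)) (p : Dataset S A T N → Prop)
    [DecidablePred p] (hp : ∀ D, p D → ∀ i ∈ I, (D i t).1 ≠ s) :
    prodExp (M.trajProb π) (fun D => if p D then 1 else 0) ≤ Real.exp (-(I.card * (δ / 2))) := by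
  have h1 : ∑ τ : Traj S A T, M.trajProb π τ *
      Real.exp (if (τ t).1 = s then (-1 : ℝ) else 0) ≤ Real.exp (-(δ / 2)) := by
    calc _ ≤ M.trajExp π (fun τ => 1 - 1 / 2 * (if (τ t).1 = s then (1 : ℝ) else 0)) := by
          refine M.trajExp_mono π fun τ => ?_
          split_ifs
          · have h2 : Real.exp (-1) * Real.exp 1 = 1 := by rw [← Real.exp_add]; simp
            have := Real.exp_one_gt_d9
            have := Real.exp_pos (-1)
            nlinarith
          · simp
      _ = 1 - 1 / 2 * M.stateDist π t s := by
          rw [trajExp_sub, trajExp_one, trajExp_const_mul]; rfl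
      _ ≤ _ := by linarith [Real.add_one_le_exp (-(δ / 2))]
  refine (prodExp.chernoff (M.trajProb_nonneg _) (M.sum_trajProb _) I _ h1 p (c := 0)
    fun D hD => ?_).trans (Real.exp_le_exp.2 (le_of_eq (by ring)))
  rw [Finset.sum_congr rfl fun i hi => if_neg (hp D hD i hi)]
  simp

end EpisodicMDP

theorem card_filter_fin_Ico (N : ℕ) {a b : ℕ} (hb : b ≤ N) :
    (Finset.univ.filter fun i : Fin N => a ≤ (i : ℕ) ∧ (i : ℕ) < b).card = b - a := by
  rw [← Nat.card_Ico, ← Finset.card_map Fin.valEmbedding]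
  congr 1
  ext x
  simp only [Finset.mem_map, Finset.mem_filter, Finset.mem_univ, true_and, Fin.valEmbedding_apply,
    Finset.mem_Ico]
  exact ⟨fun ⟨i, h, hx⟩ => hx ▸ h, fun h => ⟨⟨x, h.2.trans_le hb⟩, h, rfl⟩⟩

/-! ### Error budget and assembly of the learner -/

namespace EpisodicMDP

/-- The two parts of the error of the learner are of order `ℓ / N`. -/
theorem error_bound_le {N T : ℕ} (hN : 0 < N) {ℓ δ : ℝ}
    (hℓ : ℓ = 1 + Real.log ((N : ℝ) * ((T : ℝ) + 1))) (hδ : δ = 24576 * ℓ / N) :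
    204 * δ + 9 * (1 + (T + 2) * (2 + 1 / (3 * δ))) *
      Real.exp (-((N : ℝ) / 8 * (3 * δ / 3072))) +
      3 * (T + 1) * Real.exp (-((N : ℝ) / 8 * (δ / 2))) ≤ 5013570 * ℓ / N := by
  have hN1 : (1 : ℝ) ≤ N := by exact_mod_cast hN
  have hT0 : (0 : ℝ) ≤ T := Nat.cast_nonneg T
  set x : ℝ := (N : ℝ) * ((T : ℝ) + 1) with hx
  have hxN : (N : ℝ) ≤ x := by rw [hx]; nlinarith
  have hxT : (T : ℝ) + 1 ≤ x := by rw [hx]; nlinarith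
  have hx1 : 1 ≤ x := hN1.trans hxN
  have hx0 : 0 < x := by linarith
  have hℓ1 : 1 ≤ ℓ := by rw [hℓ]; linarith [Real.log_nonneg hx1]
  have hexp : ∀ y : ℝ, 2 * ℓ ≤ y → Real.exp (-y) ≤ 1 / x ^ 2 := by
    intro y hy
    have h1 : -y ≤ -(2 * Real.log x) := by linarith [hℓ]
    refine (Real.exp_le_exp.2 h1).trans (le_of_eq ?_)
    rw [Real.exp_neg, mul_comm, Real.exp_mul, Real.exp_log hx0, one_div]
    norm_num
  have hNδ : (N : ℝ) * δ = 24576 * ℓ := by rw [hδ]; field_simp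
  have hδ0 : 0 < δ := by rw [hδ]; positivity
  -- The constant 24576 = 3 · 8192 makes this exponent 3ℓ. Only 2ℓ is needed: the resulting factor
  -- 1/x² beats the prefactors of order x.
  have e1 := hexp ((N : ℝ) / 8 * (3 * δ / 3072)) (by linarith)
  have e2 := hexp ((N : ℝ) / 8 * (δ / 2)) (by linarith)
  have hinv : 1 / (3 * δ) ≤ N := by
    rw [div_le_iff₀ (by positivity)]; nlinarith
  have hK : 1 + ((T : ℝ) + 2) * (2 + 1 / (3 * δ)) ≤ 7 * x := by
    have h1 : ((T : ℝ) + 2) * (2 + 1 / (3 * δ)) ≤ (2 * (T + 1)) * (3 * N) :=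
      mul_le_mul (by linarith) (by linarith) (by positivity) (by positivity)
    have h2 : (2 * ((T : ℝ) + 1)) * (3 * N) = 6 * x := by rw [hx]; ring
    linarith
  have t1 : 9 * (1 + ((T : ℝ) + 2) * (2 + 1 / (3 * δ))) *
      Real.exp (-((N : ℝ) / 8 * (3 * δ / 3072))) ≤ 63 * (ℓ / N) := by
    calc _ ≤ 9 * (7 * x) * (1 / x ^ 2) :=
          mul_le_mul (by linarith) e1 (Real.exp_nonneg _) (by positivity)
      _ = 63 * (1 / x) := by field_simp; norm_num
      _ ≤ 63 * (ℓ / N) := by gcongr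
  have t2 : 3 * ((T : ℝ) + 1) * Real.exp (-((N : ℝ) / 8 * (δ / 2))) ≤ 3 * (ℓ / N) := by
    calc _ ≤ 3 * x * (1 / x ^ 2) :=
          mul_le_mul (by linarith) e2 (Real.exp_nonneg _) (by positivity)
      _ = 3 * (1 / x) := by field_simp
      _ ≤ 3 * (ℓ / N) := by gcongr
  have t3 : 204 * δ = 5013504 * (ℓ / N) := by rw [hδ]; ring
  have t4 : 5013570 * ℓ / N = 5013570 * (ℓ / N) := by ring
  rw [t4, t3]
  linarith

theorem mimicsFirstHalf_of_extends {πE : DetPolicy S A T} {D : Dataset S A T N}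
    {π : RandPolicy S A T} (hD : PlayedBy πE D) (hπ : π.Extends (firstHalf D)) :
    MimicsFirstHalf πE D π :=
  fun _ hi t => hπ t _ _ (firstHalf_eq_some hD hi t)

/-- A learner which mimics the expert on the first half of the dataset, and for which the
expectation of every test function of the last state and action has bias `O(log (N H) / N)`. -/
theorem exists_learner [Nonempty A] (M : EpisodicMDP (Fin 3) A T) (hN : 0 < N) :
    ∃ L : Learner (Fin 3) A T N, ∀ πE : DetPolicy (Fin 3) A T,
      (∀ D, PlayedBy πE D → MimicsFirstHalf πE D (L D)) ∧
      ∀ r : Fin 3 → A → ℝ, (∀ s a, r s a ∈ Set.Icc (0 : ℝ) 1) →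
        |prodExp (M.trajProb πE.toRand) (fun D => M.lastExp (L D) r) - M.lastExp πE.toRand r| ≤
          5013570 * (1 + Real.log ((N : ℝ) * ((T : ℝ) + 1))) / N := by
  classical
  obtain ⟨ℓ, hℓ⟩ : ∃ ℓ, ℓ = 1 + Real.log ((N : ℝ) * ((T : ℝ) + 1)) := ⟨_, rfl⟩
  rw [← hℓ]
  have hN1 : (1 : ℝ) ≤ N := by exact_mod_cast hN
  have hℓ1 : 1 ≤ ℓ := by
    rw [hℓ]
    linarith [Real.log_nonneg (show (1 : ℝ) ≤ (N : ℝ) * ((T : ℝ) + 1) by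
      nlinarith [(Nat.cast_nonneg T : (0 : ℝ) ≤ T)])]
  -- Below four trajectories the quarter `Ia` would be empty, but the claimed bound then exceeds
  -- one.
  rcases lt_or_ge N 4 with h4 | h4
  · choose π hπ using fun D : Dataset (Fin 3) A T N => exists_extends (A := A) (firstHalf D)
    refine ⟨π, fun πE => ⟨fun D hD => mimicsFirstHalf_of_extends hD (hπ D), fun r hr => ?_⟩⟩
    refine (abs_sub_le_one (M.prodExp_mem _ fun D => M.lastExp_mem (π D) hr)
      (M.lastExp_mem _ hr)).trans ?_
    have : (N : ℝ) < 4 := by exact_mod_cast h4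
    rw [le_div_iff₀ (by linarith)]
    linarith
  obtain ⟨δ, hδ⟩ : ∃ δ, δ = 24576 * ℓ / N := ⟨_, rfl⟩
  have hδ0 : 0 < δ := by rw [hδ]; positivity
  have herr := error_bound_le (T := T) hN hℓ hδ
  set J : Finset (Fin N) := Finset.univ.filter fun i => 0 ≤ (i : ℕ) ∧ (i : ℕ) < N / 2 with hJ
  set Ia : Finset (Fin N) := Finset.univ.filter fun i =>
    N / 2 ≤ (i : ℕ) ∧ (i : ℕ) < N / 2 + N / 4 with hIa
  set Ib : Finset (Fin N) := Finset.univ.filter fun i =>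
    N / 2 + N / 4 ≤ (i : ℕ) ∧ (i : ℕ) < N with hIb
  have hsize : ∀ {I : Finset (Fin N)}, N ≤ 8 * I.card → (N : ℝ) / 8 ≤ I.card := by
    intro I hI
    have : (N : ℝ) ≤ 8 * I.card := by exact_mod_cast hI
    linarith
  have cJ : (N : ℝ) / 8 ≤ J.card := hsize (by rw [hJ, card_filter_fin_Ico N (by omega)]; omega)
  have cA : (N : ℝ) / 8 ≤ Ia.card := hsize (by rw [hIa, card_filter_fin_Ico N (by omega)]; omega)
  have cB : (N : ℝ) / 8 ≤ Ib.card := hsize (by rw [hIb, card_filter_fin_Ico N le_rfl]; omega)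
  have hab : Disjoint Ia Ib := by
    rw [Finset.disjoint_left]
    intro i h1 h2
    simp only [hIa, hIb, Finset.mem_filter, Finset.mem_univ, true_and] at h1 h2
    omega
  have hJab : ∀ i ∈ Ia ∪ Ib, i ∉ J := by
    intro i h1 h2
    simp only [hIa, hIb, hJ, Finset.mem_union, Finset.mem_filter, Finset.mem_univ, true_and] at h1 h2
    omega
  choose e he1 he2 he3 using fun κ : PartialPolicy (Fin 3) A T =>
    M.exists_learner_of_partial κ hδ0 hab (n := (N : ℝ) / 8) (by positivity) cA cB
  refine ⟨fun D => e (firstHalf D) D, fun πE =>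
    ⟨fun D hD => mimicsFirstHalf_of_extends hD (he1 _ D), fun r hr => ?_⟩⟩
  have hnn := M.trajProb_nonneg πE.toRand
  have hone := M.sum_trajProb πE.toRand
  -- `κ` reads only the coordinates in `J`, and the matching step only those outside it. The two
  -- halves can thus be sampled independently and the first one frozen.
  have hpw : ∀ D D' : Dataset (Fin 3) A T N,
      e (firstHalf (J.piecewise D D')) (J.piecewise D D') = e (firstHalf D) D' := by
    intro D D'
    have h1 : firstHalf (J.piecewise D D') = firstHalf D := firstHalf_congr fun i hi => by
      rw [Finset.piecewise_eq_of_mem]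
      simp [hJ, hi]
    rw [h1]
    exact he2 _ _ _ fun i hi => Finset.piecewise_eq_of_notMem _ _ _ (hJab i hi)
  rw [prodExp.split J hone]
  simp only [hpw]
  rw [← prodExp.const (ι := Fin N) hone (M.lastExp πE.toRand r), ← prodExp.sub]
  refine (prodExp.abs_le hnn _).trans ?_
  let miss : Fin (T + 1) → Fin 3 → Dataset (Fin 3) A T N → Prop := fun t s D =>
    firstHalf D t s = none ∧ δ < M.stateDist πE.toRand t s
  set ε := 204 * δ + 9 * (1 + ((T : ℝ) + 2) * (2 + 1 / (3 * δ))) *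
    Real.exp (-((N : ℝ) / 8 * (3 * δ / 3072))) with hε
  have hε0 : 0 ≤ ε := by positivity
  have hpt : ∀ D : Dataset (Fin 3) A T N, ∏ i, M.trajProb πE.toRand (D i) ≠ 0 →
      |prodExp (M.trajProb πE.toRand) (fun D' => M.lastExp (e (firstHalf D) D') r) -
        M.lastExp πE.toRand r| ≤ ε + ∑ t, ∑ s, if miss t s D then (1 : ℝ) else 0 := by
    intro D hD
    have hind : ∀ t s, (0 : ℝ) ≤ if miss t s D then (1 : ℝ) else 0 := by
      intro t s; split_ifs <;> norm_num
    by_cases hbad : ∃ t s, miss t s D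
    · obtain ⟨t, s, hts⟩ := hbad
      have h1 : (1 : ℝ) ≤ ∑ t, ∑ s, if miss t s D then (1 : ℝ) else 0 := by
        calc (1 : ℝ) = if miss t s D then (1 : ℝ) else 0 := (if_pos hts).symm
          _ ≤ ∑ s, if miss t s D then (1 : ℝ) else 0 :=
            Finset.single_le_sum (f := fun s => if miss t s D then (1 : ℝ) else 0)
              (fun s _ => hind t s) (Finset.mem_univ s)
          _ ≤ _ := Finset.single_le_sum
            (f := fun t => ∑ s, if miss t s D then (1 : ℝ) else 0)
            (fun t _ => Finset.sum_nonneg fun s _ => hind t s) (Finset.mem_univ t)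
      have h2 := abs_sub_le_one
        (M.prodExp_mem πE.toRand fun D' => M.lastExp_mem (e (firstHalf D) D') hr)
        (M.lastExp_mem πE.toRand hr)
      linarith
    · push Not at hbad
      refine (he3 (firstHalf D) πE (extends_firstHalf (playedBy_of_weight_ne_zero hD))
        (fun t s hts => ?_) r hr).trans
        (le_add_of_nonneg_right (Finset.sum_nonneg fun t _ => Finset.sum_nonneg fun s _ => hind t s))
      by_contra hlt
      exact hbad t s ⟨hts, not_le.1 hlt⟩
  have hmiss : ∀ t s, prodExp (M.trajProb πE.toRand)
      (fun D : Dataset (Fin 3) A T N => if miss t s D then (1 : ℝ) else 0) ≤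
      Real.exp (-((N : ℝ) / 8 * (δ / 2))) := by
    intro t s
    by_cases hlt : δ < M.stateDist πE.toRand t s
    · refine (M.prodExp_unseen_le πE.toRand t s hlt J (miss t s) fun D hD i hi hs => ?_).trans
        (Real.exp_le_exp.2 (neg_le_neg (mul_le_mul_of_nonneg_right cJ (by positivity))))
      have hex : ∃ i : Fin N, (i : ℕ) < N / 2 ∧ (D i t).1 = s :=
        ⟨i, by simpa [hJ] using hi, hs⟩
      have h1 := hD.1
      simp only [firstHalf, dif_pos hex] at h1
      exact absurd h1 (by simp)
    · have : (fun D : Dataset (Fin 3) A T N => if miss t s D then (1 : ℝ) else 0) = fun _ => 0 := by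
        funext D
        exact if_neg fun h => hlt h.2
      rw [this, prodExp.const hone]
      exact Real.exp_nonneg _
  refine (prodExp.mono' hnn hpt).trans (le_trans ?_ herr)
  rw [prodExp.add, prodExp.const hone, prodExp.finset_sum]
  simp only [prodExp.finset_sum]
  have : ∑ t : Fin (T + 1), ∑ s : Fin 3, prodExp (M.trajProb πE.toRand)
      (fun D : Dataset (Fin 3) A T N => if miss t s D then (1 : ℝ) else 0) ≤
      ∑ t : Fin (T + 1), ∑ s : Fin 3, Real.exp (-((N : ℝ) / 8 * (δ / 2))) :=
    Finset.sum_le_sum fun t _ => Finset.sum_le_sum fun s _ => hmiss t s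
  simp only [Finset.sum_const, Finset.card_univ, Fintype.card_fin, nsmul_eq_mul] at this
  push_cast at this
  linarith

end EpisodicMDP

/-- The total variation distance is controlled by test functions with values in `[0, 1]`. -/
theorem tvDist_le_of_forall_test {p q : S → A → ℝ} {ε : ℝ}
    (h : ∀ r : S → A → ℝ, (∀ s a, r s a ∈ Set.Icc (0 : ℝ) 1) →
      |∑ s, ∑ a, r s a * (p s a - q s a)| ≤ ε) : tvDist p q ≤ ε := by
  classical
  have h1 := (abs_le.1 (h (fun s a => if q s a < p s a then 1 else 0)
    (fun s a => by split_ifs <;> simp))).2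
  have h2 := (abs_le.1 (h (fun s a => if q s a < p s a then 0 else 1)
    (fun s a => by split_ifs <;> simp))).1
  have h3 : ∑ s, ∑ a, |p s a - q s a| =
      ∑ s, ∑ a, (if q s a < p s a then 1 else 0) * (p s a - q s a) -
      ∑ s, ∑ a, (if q s a < p s a then 0 else 1) * (p s a - q s a) := by
    simp only [← Finset.sum_sub_distrib]
    refine Finset.sum_congr rfl fun s _ => Finset.sum_congr rfl fun a _ => ?_
    split_ifs with hlt
    · rw [abs_of_pos (sub_pos.2 hlt)]; ring
    · rw [abs_of_nonpos (sub_nonpos.2 (not_lt.1 hlt))]; ring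
  rw [tvDist, h3]
  linarith

end

/-! ### The main theorem -/

theorem mainTheorem7 :
    ∃ (C : ℝ) (k : ℕ), 0 < C ∧
      ∀ (A : Type) [Fintype A] [DecidableEq A] [Nonempty A] (T N : ℕ), 0 < N →
      ∀ M : EpisodicMDP (Fin 3) A T,
      ∃ L : Learner (Fin 3) A T N,
      ∀ πE : DetPolicy (Fin 3) A T,
        (∀ D, PlayedBy πE D → MimicsFirstHalf πE D (L D)) ∧
        tvDist (fun s a => M.dataExp πE.toRand (fun D => M.occ (L D) (Fin.last T) s a))
            (M.occ πE.toRand (Fin.last T))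
          ≤ C * (1 + Real.log ((N : ℝ) * ((T : ℝ) + 1))) ^ k / N ∧
        ∀ r : Fin (T + 1) → Fin 3 → A → ℝ,
          (∀ t s a, 0 ≤ r t s a ∧ r t s a ≤ 1) →
          (∀ t s a, t ≠ Fin.last T → r t s a = 0) →
          |M.value r πE.toRand - M.dataExp πE.toRand (fun D => M.value r (L D))|
            ≤ C * (1 + Real.log ((N : ℝ) * ((T : ℝ) + 1))) ^ k / N := by
  refine ⟨5013570, 1, by norm_num, fun A _ _ _ T N hN M => ?_⟩
  obtain ⟨L, hL⟩ := M.exists_learner hN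
  refine ⟨L, fun πE => ⟨(hL πE).1, ?_, fun r hr hr0 => ?_⟩⟩
  · rw [pow_one]
    -- By linearity, testing the averaged occupancies against `r` gives the bias of `lastExp`. The
    -- learner does not depend on `r`, so one learner serves all tests.
    refine tvDist_le_of_forall_test fun r hr => le_trans (le_of_eq ?_) ((hL πE).2 r hr)
    congr 1
    simp only [EpisodicMDP.lastExp_eq_sum_occ, mul_sub, Finset.sum_sub_distrib]
    congr 1
    rw [prodExp.finset_sum]
    refine Finset.sum_congr rfl fun s _ => ?_
    rw [prodExp.finset_sum]
    exact Finset.sum_congr rfl fun a _ => (prodExp.const_mul _ _).symm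
  · rw [pow_one, abs_sub_comm]
    simp only [M.value_of_terminal _ r hr0]
    exact (hL πE).2 (r (Fin.last T)) fun s a => hr _ s a
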